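/- Let $\Gamma=(V,E,s,r)$ be a finite quiver (finite sets $V$ of vertices and $E$ of arrows, with source and range maps $s,r:E\to V$; loops and parallel arrows are allowed) whose underlying undirected graph $|\Gamma|$ is connected (in particular $V\neq\emptyset$). Here $|\Gamma|$ is the multigraph with vertex set $V$ and one edge joining $s(\alpha)$ and $r(\alpha)$ for every $\alpha\in E$. A Hilbert representation $(H,f)$ of $\Gamma$ consists of complex Hilbert spaces $H_v$ ($v\in V$) and bounded linear operators $f_\alpha:H_{s(\alpha)}\to H_{r(\alpha)}$ ($\alpha\in E$). An isomorphism $(H,f)\to(K,g)$ is a family of bounded invertible operators $\varphi_v:H_v\to K_v$ with $\varphi_{r(\alpha)}f_\alpha=g_\alpha\varphi_{s(\alpha)}$ for all $\alpha\in E$. The direct sum $(K,g)\oplus(K',g')$ has the spaces $K_v\oplus K'_v$ and the operators $g_\alpha\oplus g'_\alpha$. A Hilbert representation is zero if all its spaces are zero, infinite-dimensional if $H_v$ is infinite-dimensional for some $v\in V$, and indecomposable if it is non-zero and not isomorphic to a direct sum of two non-zero Hilbert representations. If there exists no infinite-dimensional, indecomposable Hilbert representation of $\Gamma$ on separable Hilbert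 spaces (in particular, if there exists no infinite-dimensional, indecomposable Hilbert representation of $\Gamma$ at all), then $|\Gamma|$ is isomorphic, as a multigraph, to one of the Dynkin diagrams $A_n$ $(n\ge 1)$, $D_n$ $(n\ge 4)$, $E_6$, $E_7$, $E_8$. Here $A_n$ is the path on $n$ vertices; $D_n$ is the tree on $n$ vertices in which three arms with $1$, $1$, $n-3$ vertices are attached to one vertex; and $E_n$ $(n=6,7,8)$ is the tree on $n$ vertices in which three arms with $1$, $2$, $n-4$ vertices are attached to one vertex. -/

import Mathlib

universe u v w

/-- A Hilbert representation of a quiver: a complex Hilbert space `H x` for every vertex `x` and a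
bounded operator `H a → H b` for every arrow `a ⟶ b`. -/
structure HilbertRep (V : Type u) [Quiver.{v + 1} V] where
  H : V → Type w
  [normedAddCommGroup : ∀ x, NormedAddCommGroup (H x)]
  [innerProductSpace : ∀ x, InnerProductSpace ℂ (H x)]
  [completeSpace : ∀ x, CompleteSpace (H x)]
  f : ∀ {a b : V}, (a ⟶ b) → (H a →L[ℂ] H b)

namespace HilbertRep

attribute [instance] HilbertRep.normedAddCommGroup HilbertRep.innerProductSpace
  HilbertRep.completeSpace

variable {V : Type u} [Quiver.{v + 1} V]

/-- An isomorphism of Hilbert representations: bounded invertible operators at the vertices,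
intertwining the operators on the arrows. -/
structure Iso (R S : HilbertRep.{u, v, w} V) where
  φ : ∀ x, R.H x ≃L[ℂ] S.H x
  comm : ∀ {a b : V} (e : a ⟶ b) (ξ : R.H a), φ b (R.f e ξ) = S.f e (φ a ξ)

/-- The direct sum; `WithLp 2 (K × K')` is the Hilbert space direct sum `K ⊕ K'`. -/
noncomputable def directSum (K K' : HilbertRep.{u, v, w} V) : HilbertRep.{u, v, w} V where
  H x := WithLp 2 (K.H x × K'.H x)
  f {a b} e :=
    ((WithLp.prodContinuousLinearEquiv 2 ℂ (K.H b) (K'.H b)).symm.toContinuousLinearMap.comp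
      ((K.f e).prodMap (K'.f e))).comp
      (WithLp.prodContinuousLinearEquiv 2 ℂ (K.H a) (K'.H a)).toContinuousLinearMap

theorem directSum_f_apply (K K' : HilbertRep.{u, v, w} V) {a b : V} (e : a ⟶ b)
    (ξ : K.H a) (η : K'.H a) :
    (directSum K K').f e (WithLp.toLp 2 (ξ, η)) = WithLp.toLp 2 (K.f e ξ, K'.f e η) := rfl

/-- The zero representation: all the Hilbert spaces are zero. -/
def IsZero (R : HilbertRep.{u, v, w} V) : Prop :=
  ∀ x, Subsingleton (R.H x)

/-- Isomorphic to a direct sum of two non-zero Hilbert representations. -/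
def IsDecomposable (R : HilbertRep.{u, v, w} V) : Prop :=
  ∃ K K' : HilbertRep.{u, v, w} V, ¬ K.IsZero ∧ ¬ K'.IsZero ∧ Nonempty (Iso R (directSum K K'))

/-- Non-zero and not decomposable. -/
def IsIndecomposable (R : HilbertRep.{u, v, w} V) : Prop :=
  ¬ R.IsZero ∧ ¬ R.IsDecomposable

/-- Some of the Hilbert spaces is infinite-dimensional. -/
def IsInfiniteDimensional (R : HilbertRep.{u, v, w} V) : Prop :=
  ∃ x, ¬ FiniteDimensional ℂ (R.H x)

/-- All the Hilbert spaces are separable. -/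
def IsSeparable (R : HilbertRep.{u, v, w} V) : Prop :=
  ∀ x, TopologicalSpace.SeparableSpace (R.H x)

end HilbertRep

/-- The underlying undirected graph is connected: there are vertices, and any two of them are joined
by a walk whose steps are arrows traversed forwards or backwards. -/
def QuiverConnected (V : Type u) [Quiver.{v + 1} V] : Prop :=
  Nonempty V ∧ Quiver.IsStronglyConnected (Quiver.Symmetrify V)

/-- The underlying undirected graph of the quiver (a multigraph: every arrow gives one edge, loops
and parallel edges are kept) is isomorphic to the simple graph `G`, by a bijection of the vertices
and a bijection of the edges that respect end points. -/
def UnderlyingGraphIs (V : Type u) [Quiver.{v + 1} V] {W : Type*} (G : SimpleGraph W) : Prop :=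
  ∃ (φ : V ≃ W) (ψ : Quiver.Total V ≃ G.edgeSet),
    ∀ e : Quiver.Total V, (ψ e : Sym2 W) = s(φ e.left, φ e.right)

/-- The path `0 - 1 - ⋯ - (n-2)` together with one more vertex `n-1`, which is joined to the
vertex `k` of the path only (used for `k + 1 < n`). -/
def branchGraph (n k : ℕ) : SimpleGraph (Fin n) :=
  SimpleGraph.fromRel fun i j =>
    (i.val + 1 = j.val ∧ j.val + 1 < n) ∨ (i.val = k ∧ j.val + 1 = n)

/-- The Dynkin diagram `A_n`: the path on `n` vertices. -/
def dynkinA (n : ℕ) : SimpleGraph (Fin n) := SimpleGraph.pathGraph n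

/-- The Dynkin diagram `D_n` (`n ≥ 4`): three arms with `1`, `1` and `n - 3` vertices at a
branching vertex. -/
def dynkinD (n : ℕ) : SimpleGraph (Fin n) := branchGraph n (n - 3)

/-- The Dynkin diagrams `E_n` (`n = 6, 7, 8`): three arms with `1`, `2` and `n - 4` vertices at a
branching vertex. -/
def dynkinE (n : ℕ) : SimpleGraph (Fin n) := branchGraph n 2

/-!
A connected quiver whose graph is not a Dynkin diagram has an infinite-dimensional indecomposable
representation on separable spaces. It is found among representations built from the unilateral
shift `S` of `ℓ²(ℕ)`, whose commutant contains no idempotents other than `0` and `1`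
(`ShiftSpace.eq_zero_or_eq_id_of_idempotent`). A decomposition would give a non-trivial idempotent
endomorphism (`HilbertRep.IsDecomposable.exists_idempotent`), so in every case it suffices to see
that idempotent endomorphisms come from this commutant.

If an arrow can be removed without disconnecting the quiver, take `ℓ²(ℕ)` at all vertices, the shift
on that arrow and the identity on the others (`HilbertRep.exists_indecomposable_of_connected_ne`).
Otherwise the graph is a tree.

For trees, let a connected core of vertices carry a sum of copies of `ℓ²(ℕ)`, and let every arm
attached to the core correspond to a flag of closed subspaces. Going out along an arm, an arrow
towards the core passes to a smaller subspace and an arrow away from it to a quotient, realized as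
an orthogonal complement, so that every vertex carries a layer of the flag. For every orientation an
endomorphism is then an operator on the sum that preserves all members of the flags
(`arm_invariant`, `HilbertRep.exists_indecomposable_of_flags`); no reflection functors are needed.
Systems of flags in which `S` occurs as a parameter, such that only trivial idempotents preserve all
the flags, exist for the types of the extended Dynkin diagrams `D₄`, `E₆`, `E₇` and `E₈`.

If a tree has four leaves, these serve as arms for `D₄` and all other vertices as the core; this
replaces the extended diagrams `D_n`. A tree with fewer leaves is a path or has a single branching
vertex with three arms (`SimpleGraph.IsTree.four_le_card_leaves`,
`SimpleGraph.IsTree.exists_isSpider`), and excluding arm lengths at least `(2, 2, 2)`, `(1, 3, 3)`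
and `(1, 2, 5)` leaves the Dynkin diagrams.
-/

/-! ### Idempotent endomorphisms -/

namespace HilbertRep

variable {V : Type u} [Quiver.{v + 1} V]

/-- The projection of a direct sum onto its first summand. -/
noncomputable def directSumFst (K K' : HilbertRep.{u, v, w} V) (x : V) :
    (directSum K K').H x →ₗ[ℂ] (directSum K K').H x :=
  ((WithLp.prodContinuousLinearEquiv 2 ℂ (K.H x) (K'.H x)).symm.toLinearMap ∘ₗ
    LinearMap.prodMap LinearMap.id 0) ∘ₗ
      (WithLp.prodContinuousLinearEquiv 2 ℂ (K.H x) (K'.H x)).toLinearMap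

theorem directSumFst_apply (K K' : HilbertRep.{u, v, w} V) (x : V) (ξ : K.H x) (η : K'.H x) :
    directSumFst K K' x (WithLp.toLp 2 (ξ, η)) = WithLp.toLp 2 (ξ, 0) := rfl

/-- The projection onto the first summand is a non-trivial idempotent endomorphism of a
decomposable representation. Only linearity of the endomorphism is recorded, since boundedness plays
no role in excluding such idempotents. -/
theorem IsDecomposable.exists_idempotent {R : HilbertRep.{u, v, w} V} (h : R.IsDecomposable) :
    ∃ T : ∀ x, R.H x →ₗ[ℂ] R.H x, (∀ x ξ, T x (T x ξ) = T x ξ) ∧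
      (∀ {a b : V} (e : a ⟶ b) ξ, T b (R.f e ξ) = R.f e (T a ξ)) ∧
      (∃ x ξ, T x ξ ≠ 0) ∧ ∃ x ξ, T x ξ ≠ ξ := by
  obtain ⟨K, K', hK, hK', ⟨φ⟩⟩ := h
  have hpp : ∀ x p, directSumFst K K' x (directSumFst K K' x p) = directSumFst K K' x p :=
    fun _ _ => rfl
  have hpf : ∀ {a b : V} (e : a ⟶ b) p, directSumFst K K' b ((directSum K K').f e p) =
      (directSum K K').f e (directSumFst K K' a p) := by
    intro a b e p
    have h : ∀ ξ η, directSumFst K K' b ((directSum K K').f e (WithLp.toLp 2 (ξ, η))) =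
        (directSum K K').f e (directSumFst K K' a (WithLp.toLp 2 (ξ, η))) := fun ξ η => by
      rw [directSumFst_apply, directSum_f_apply, directSum_f_apply, map_zero, directSumFst_apply]
    exact h (WithLp.fst p) (WithLp.snd p)
  have hp0 : ∃ x p, directSumFst K K' x p ≠ 0 := by
    simp only [IsZero, not_forall, not_subsingleton_iff_nontrivial] at hK
    obtain ⟨x, hx⟩ := hK
    obtain ⟨η, hη⟩ := exists_ne (0 : K.H x)
    exact ⟨x, WithLp.toLp 2 (η, 0), fun h0 =>
      hη (congrArg (fun p : WithLp 2 (K.H x × K'.H x) => p.fst) h0)⟩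
  have hp1 : ∃ x p, directSumFst K K' x p ≠ p := by
    simp only [IsZero, not_forall, not_subsingleton_iff_nontrivial] at hK'
    obtain ⟨x, hx⟩ := hK'
    obtain ⟨η, hη⟩ := exists_ne (0 : K'.H x)
    exact ⟨x, WithLp.toLp 2 (0, η), fun h0 =>
      hη (congrArg (fun p : WithLp 2 (K.H x × K'.H x) => p.snd) h0).symm⟩
  generalize directSumFst K K' = P at *
  generalize directSum K K' = D at *
  refine ⟨fun x => (φ.φ x).symm.toLinearMap ∘ₗ P x ∘ₗ (φ.φ x).toLinearMap, ?_, ?_, ?_, ?_⟩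
  · intro x ξ
    simp [hpp]
  · intro a b e ξ
    apply (φ.φ b).injective
    rw [φ.comm]
    simp [φ.comm, hpf]
  · obtain ⟨x, p, hp⟩ := hp0
    exact ⟨x, (φ.φ x).symm p, by simpa using hp⟩
  · obtain ⟨x, p, hp⟩ := hp1
    exact ⟨x, (φ.φ x).symm p, by simpa using hp⟩

end HilbertRep

/-! ### The unilateral shift -/

/-- The Hilbert space `ℓ²(ℕ)`, placed in an arbitrary universe. -/
abbrev ShiftSpace : Type w := lp (fun _ : ULift.{w} ℕ => ℂ) 2

instance : TopologicalSpace.SeparableSpace ShiftSpace.{w} := by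
  rw [← TopologicalSpace.isSeparable_univ_iff]
  let b : HilbertBasis (ULift.{w} ℕ) ℂ ShiftSpace.{w} := ⟨LinearIsometryEquiv.refl ℂ _⟩
  have h := (Set.countable_range b).isSeparable.span (R := ℂ)
  have h2 := h.closure
  rw [← Submodule.topologicalClosure_coe, b.dense_span] at h2
  simpa using h2

namespace ShiftSpace

theorem add_apply (f g : ShiftSpace.{w}) (n : ULift.{w} ℕ) : (f + g) n = f n + g n := rfl

theorem sub_apply (f g : ShiftSpace.{w}) (n : ULift.{w} ℕ) : (f - g) n = f n - g n := rfl

theorem smul_apply (c : ℂ) (f : ShiftSpace.{w}) (n : ULift.{w} ℕ) : (c • f) n = c * f n := rfl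

theorem summable_norm_sq (f : ShiftSpace.{w}) : Summable fun n : ℕ => ‖f ⟨n⟩‖ ^ (2 : ℕ) := by
  have h := (lp.memℓp f).summable (by norm_num)
  have h2 := (Equiv.ulift.{w}.symm.summable_iff (α := ℝ)).2 h
  simpa [Function.comp_def] using h2

theorem norm_sq_eq_tsum (f : ShiftSpace.{w}) : ‖f‖ ^ (2 : ℕ) = ∑' n : ℕ, ‖f ⟨n⟩‖ ^ (2 : ℕ) := by
  have h := lp.norm_rpow_eq_tsum (p := 2) (by norm_num) f
  rw [← Equiv.ulift.{w}.symm.tsum_eq] at h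
  simpa using h

/-- The unilateral shift on `ℓ²(ℕ)`. -/
noncomputable def shift : ShiftSpace.{w} →L[ℂ] ShiftSpace.{w} :=
  LinearMap.mkContinuous
    { toFun := fun f => ⟨fun n => if n.down = 0 then 0 else f ⟨n.down - 1⟩, by
        apply memℓp_gen
        rw [← Equiv.ulift.{w}.symm.summable_iff, ← summable_nat_add_iff 1]
        simpa using summable_norm_sq f⟩
      map_add' := fun f g => by
        ext n
        by_cases h : n.down = 0 <;> simp [h, add_apply]
      map_smul' := fun c f => by
        ext n
        by_cases h : n.down = 0 <;> simp [h, smul_apply] } 1 fun f => by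
    rw [one_mul, ← abs_of_nonneg (norm_nonneg f), ← abs_of_nonneg (norm_nonneg _), ← sq_le_sq,
      norm_sq_eq_tsum, norm_sq_eq_tsum, Summable.tsum_eq_zero_add]
    · simp [-lp.coeFn_smul]
    · exact summable_norm_sq _

theorem shift_apply_succ (f : ShiftSpace.{w}) (n : ℕ) : shift f ⟨n + 1⟩ = f ⟨n⟩ := rfl

theorem shift_apply_zero (f : ShiftSpace.{w}) : shift f ⟨0⟩ = 0 := rfl

theorem shift_injective : Function.Injective (shift.{w}) := fun f g h => by
  ext ⟨n⟩
  rw [← shift_apply_succ, h, shift_apply_succ]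

theorem mem_range_shift {f : ShiftSpace.{w}} (h : f ⟨0⟩ = 0) : ∃ g, shift g = f := by
  refine ⟨⟨fun n => f ⟨n.down + 1⟩, ?_⟩, ?_⟩
  · apply memℓp_gen
    rw [← Equiv.ulift.{w}.symm.summable_iff]
    simpa [Function.comp_def] using (summable_nat_add_iff 1).2 (summable_norm_sq f)
  · ext ⟨n⟩
    cases n with
    | zero => rw [shift_apply_zero, h]
    | succ n => rfl

theorem shift_iterate_apply (k : ℕ) (f : ShiftSpace.{w}) {n : ℕ} (h : n < k) :
    shift^[k] f ⟨n⟩ = 0 := by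
  induction k generalizing n with
  | zero => omega
  | succ k ih =>
    rw [Function.iterate_succ_apply']
    cases n with
    | zero => rfl
    | succ n => exact ih (Nat.succ_lt_succ_iff.1 h)

/-- An idempotent commuting with the shift whose range consists of sequences starting with `0`
vanishes: its powers, all equal to it, map into arbitrarily high powers of the shift. -/
theorem eq_zero_of_idempotent {A : ShiftSpace.{w} →ₗ[ℂ] ShiftSpace.{w}} (hA : ∀ x, A (A x) = A x)
    (hS : ∀ x, A (shift x) = shift (A x)) (h0 : ∀ x, A x ⟨0⟩ = 0) : A = 0 := by
  have key : ∀ k x, ∃ y, A x = shift^[k] (A y) := by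
    intro k
    induction k with
    | zero => exact fun x => ⟨x, rfl⟩
    | succ k ih =>
      intro x
      obtain ⟨y, hy⟩ := mem_range_shift (h0 x)
      obtain ⟨z, hz⟩ := ih y
      refine ⟨z, ?_⟩
      rw [Function.iterate_succ_apply', ← hz, ← hS, hy, hA]
  ext x ⟨n⟩
  obtain ⟨y, hy⟩ := key (n + 1) x
  rw [hy, shift_iterate_apply _ _ (Nat.lt_succ_self n)]
  rfl

/-- The commutant of the unilateral shift, even among all linear maps, contains only the trivial
idempotents. -/
theorem eq_zero_or_eq_id_of_idempotent {A : ShiftSpace.{w} →ₗ[ℂ] ShiftSpace.{w}}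
    (hA : ∀ x, A (A x) = A x) (hS : ∀ x, A (shift x) = shift (A x)) :
    A = 0 ∨ A = LinearMap.id := by
  classical
  let δ : ShiftSpace.{w} := lp.single 2 ⟨0⟩ 1
  have hδ : δ ⟨0⟩ = 1 := by simp [δ]
  -- Modulo the range of the shift, `A` is multiplication by the scalar `c`.
  set c := A δ ⟨0⟩ with hc
  have h0 : ∀ x, A x ⟨0⟩ = x ⟨0⟩ * c := by
    intro x
    obtain ⟨y, hy⟩ := mem_range_shift (f := x - x ⟨0⟩ • δ) (by
      rw [sub_apply, smul_apply, hδ, mul_one, sub_self])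
    have hx : x = shift y + x ⟨0⟩ • δ := by rw [hy]; abel
    have hAx : A x = shift (A y) + x ⟨0⟩ • A δ := by
      conv_lhs => rw [hx]
      rw [map_add, map_smul, hS]
    rw [hAx, add_apply, smul_apply, shift_apply_zero, zero_add]
  have hcc : c * c = c := by
    rw [← h0 (A δ), hA]
  rcases IsIdempotentElem.iff_eq_zero_or_one.1 hcc with h | h
  · exact Or.inl (eq_zero_of_idempotent hA hS fun x => by rw [h0, h, mul_zero])
  · right
    have := eq_zero_of_idempotent (A := LinearMap.id - A) (fun x => by simp [hA])
      (fun x => by simp [hS]) (fun x => by simp [h0, h])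
    exact (sub_eq_zero.1 this).symm

instance : Nontrivial ShiftSpace.{w} := by
  classical
  exact ⟨⟨lp.single 2 ⟨0⟩ 1, 0, fun h => by
    simpa using congrArg (fun f : ShiftSpace.{w} => f ⟨0⟩) h⟩⟩

/-- An injective endomorphism of a finite-dimensional space is onto, unlike the shift. -/
theorem not_finiteDimensional : ¬ FiniteDimensional ℂ ShiftSpace.{w} := fun _ => by
  classical
  obtain ⟨g, hg⟩ := LinearMap.surjective_of_injective (f := shift.{w}.toLinearMap) shift_injective
    (lp.single 2 ⟨0⟩ 1)
  simpa [shift_apply_zero] using congrArg (fun f : ShiftSpace.{w} => f ⟨0⟩) hg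

end ShiftSpace

/-! ### A shift on an arrow whose removal keeps the quiver connected -/

namespace HilbertRep

variable {V : Type u} [Quiver.{v + 1} V]

open Classical in
/-- The space `ℓ²(ℕ)` at every vertex, the shift on the arrow `e₀` and the identity on every other
arrow. -/
noncomputable def shiftRep (e₀ : Quiver.Total V) : HilbertRep.{u, v, w} V where
  H _ := ShiftSpace.{w}
  f {a b} e := if (⟨a, b, e⟩ : Quiver.Total V) = e₀ then ShiftSpace.shift
    else ContinuousLinearMap.id ℂ _

/-- An idempotent endomorphism acts by one operator on all vertices joined through arrows other than
`e₀`, and `e₀` makes this operator commute with the shift. -/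
theorem exists_indecomposable_of_connected_ne (e₀ : Quiver.Total V)
    (hc : ∀ a b, Relation.EqvGen
      (fun a b : V => ∃ e : a ⟶ b, (⟨a, b, e⟩ : Quiver.Total V) ≠ e₀) a b) :
    ∃ R : HilbertRep.{u, v, w} V,
      R.IsSeparable ∧ R.IsInfiniteDimensional ∧ R.IsIndecomposable := by
  refine ⟨shiftRep e₀, fun x => inferInstanceAs (TopologicalSpace.SeparableSpace ShiftSpace.{w}),
    ⟨e₀.left, ShiftSpace.not_finiteDimensional⟩,
    fun h => not_subsingleton ShiftSpace.{w} (h e₀.left), fun hd => ?_⟩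
  obtain ⟨T, hTT, hTf, ⟨a, ξ, hξ⟩, b, η, hη⟩ := hd.exists_idempotent
  change V → (ShiftSpace.{w} →ₗ[ℂ] ShiftSpace.{w}) at T
  have hconst : ∀ a b, T a = T b := by
    intro a b
    induction hc a b with
    | rel a b h =>
      obtain ⟨e, he⟩ := h
      refine LinearMap.ext fun ξ => ?_
      have := hTf e ξ
      simp only [shiftRep, if_neg he] at this
      exact this.symm
    | refl a => rfl
    | symm a b _ ih => exact ih.symm
    | trans a b c _ _ ih₁ ih₂ => exact ih₁.trans ih₂
  have hS : ∀ ξ, T e₀.left (ShiftSpace.shift ξ) = ShiftSpace.shift (T e₀.left ξ) := by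
    intro ξ
    have := hTf e₀.hom ξ
    simp only [shiftRep, if_true] at this
    rwa [hconst e₀.right e₀.left] at this
  rcases ShiftSpace.eq_zero_or_eq_id_of_idempotent (hTT e₀.left) hS with h | h
  · exact hξ (by rw [hconst a e₀.left, h]; rfl)
  · exact hη (by rw [hconst b e₀.left, h]; rfl)

/-! ### Representations by subspaces of one Hilbert space -/

variable {E : Type w} [NormedAddCommGroup E] [InnerProductSpace ℂ E]

/-- Closed subspaces of one Hilbert space at the vertices; an arrow `a ⟶ b` acts by the orthogonal
projection onto `U b`, restricted to `U a`. It is an inclusion if `U a ≤ U b`. -/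
noncomputable def subspaceRep (U : V → Submodule ℂ E) [∀ a, CompleteSpace (U a)] :
    HilbertRep.{u, v, w} V where
  H a := U a
  f {a b} _ := (U b).orthogonalProjectionOnto ∘L (U a).subtypeL

/-- The idempotent endomorphism of a decomposable `subspaceRep U`, with its components extended by
`0` on the complements `(U a)ᗮ`. -/
theorem exists_idempotent_of_subspaceRep_isDecomposable {U : V → Submodule ℂ E}
    [∀ a, CompleteSpace (U a)] (h : (subspaceRep U).IsDecomposable) :
    ∃ T : V → E →ₗ[ℂ] E, (∀ a x, T a x ∈ U a) ∧ (∀ a, ∀ x ∈ (U a)ᗮ, T a x = 0) ∧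
      (∀ a x, T a (T a x) = T a x) ∧
      (∀ {a b : V}, (a ⟶ b) → ∀ x ∈ U a, T b x - T a x ∈ (U b)ᗮ) ∧
      (∃ a, ∃ x ∈ U a, T a x ≠ 0) ∧ ∃ a, ∃ x ∈ U a, T a x ≠ x := by
  obtain ⟨T, hTT, hTf, ⟨a, ξ, hξ⟩, b, η, hη⟩ := h.exists_idempotent
  change ∀ a, U a →ₗ[ℂ] U a at T
  have hmem : ∀ a (x : U a), (U a).orthogonalProjectionOnto (x : E) = x := fun a x =>
    Submodule.orthogonalProjectionOnto_mem_subspace_eq_self x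
  refine ⟨fun a => (U a).subtype ∘ₗ T a ∘ₗ (U a).orthogonalProjectionOnto.toLinearMap,
    ?_, ?_, ?_, ?_, ?_, ?_⟩
  · exact fun a x => (T a _).2
  · intro a x hx
    simp [Submodule.orthogonalProjectionOnto_apply_of_mem_orthogonal hx]
  · intro a x
    simp only [LinearMap.comp_apply, ContinuousLinearMap.coe_coe, Submodule.subtype_apply, hmem]
    exact congrArg _ (hTT a _)
  · intro a b e x hx
    have h1 := congrArg (fun y : U b => (y : E)) (hTf e ⟨x, hx⟩)
    change ((T b ((U b).orthogonalProjectionOnto x) : U b) : E) =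
      (U b).starProjection (T a ⟨x, hx⟩ : U a) at h1
    simp only [LinearMap.comp_apply, ContinuousLinearMap.coe_coe, Submodule.subtype_apply]
    rw [hmem a ⟨x, hx⟩, h1, ← neg_sub]
    exact neg_mem ((U b).sub_starProjection_mem_orthogonal _)
  · change U a at ξ
    refine ⟨a, ξ, ξ.2, fun h0 => hξ ?_⟩
    simp only [LinearMap.comp_apply, ContinuousLinearMap.coe_coe, Submodule.subtype_apply, hmem]
      at h0
    exact Subtype.ext h0
  · change U b at η
    refine ⟨b, η, η.2, fun h0 => hη ?_⟩
    simp only [LinearMap.comp_apply, ContinuousLinearMap.coe_coe, Submodule.subtype_apply, hmem]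
      at h0
    exact Subtype.ext h0

end HilbertRep

/-! ### Flags along the arms of a quiver -/

open Classical in
/-- The pair `(l, h)` such that the vertex at distance `j` on an arm carries the layer `F h / F l`
of a flag `F 0 ≤ ⋯ ≤ F (m + 1)`. Here `o j` says that the `j`-th edge of the arm points towards
its start: then the layer shrinks to a subspace, and otherwise to a quotient. -/
noncomputable def armBounds (o : ℕ → Prop) (m : ℕ) : ℕ → ℕ × ℕ
  | 0 => (0, m + 1)
  | j + 1 => if o j then ((armBounds o m j).1, (armBounds o m j).2 - 1)
      else ((armBounds o m j).1 + 1, (armBounds o m j).2)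

theorem armBounds_add (o : ℕ → Prop) (m : ℕ) {j : ℕ} (hj : j ≤ m) :
    (armBounds o m j).1 + (m + 1 - j) = (armBounds o m j).2 := by
  induction j with
  | zero => simp [armBounds]
  | succ j ih =>
    have := ih (by omega)
    by_cases h : o j <;> simp only [armBounds, h, if_true, if_false] <;> omega

section Arm

variable {E : Type w} [NormedAddCommGroup E] [InnerProductSpace ℂ E]

/-- The layer of the flag `F` at distance `j` on an arm, realized inside the Hilbert space as an
orthogonal complement. -/
noncomputable def armSpace (F : ℕ → Submodule ℂ E) (o : ℕ → Prop) (m j : ℕ) : Submodule ℂ E :=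
  F (armBounds o m j).2 ⊓ (F (armBounds o m j).1)ᗮ

theorem armSpace_zero {F : ℕ → Submodule ℂ E} {m : ℕ} (h0 : F 0 = ⊥) (htop : F (m + 1) = ⊤)
    (o : ℕ → Prop) : armSpace F o m 0 = ⊤ := by
  simp [armSpace, armBounds, h0, htop]

theorem Submodule.exists_add_of_le {A B : Submodule ℂ E} [A.HasOrthogonalProjection] (h : A ≤ B)
    {x : E} (hx : x ∈ B) : ∃ y ∈ A, ∃ u ∈ B ⊓ Aᗮ, x = y + u :=
  ⟨A.starProjection x, A.starProjection_apply_mem x, x - A.starProjection x,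
    ⟨B.sub_mem hx (h (A.starProjection_apply_mem x)), A.sub_starProjection_mem_orthogonal x⟩,
    by abel⟩

/-- Operators on the vertices of an arm that commute with its arrows, in either orientation, are
induced by the operator at its start, which therefore preserves the flag. -/
theorem arm_invariant {m : ℕ} {F : ℕ → Submodule ℂ E} (hF : Monotone F)
    [∀ k, (F k).HasOrthogonalProjection] (h0 : F 0 = ⊥) (htop : F (m + 1) = ⊤)
    {o : ℕ → Prop} {T : ℕ → E →ₗ[ℂ] E} (hT : ∀ j ≤ m, ∀ x, T j x ∈ armSpace F o m j)
    (hT' : ∀ j ≤ m, ∀ x ∈ (armSpace F o m j)ᗮ, T j x = 0)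
    (hin : ∀ j < m, o j → ∀ x ∈ armSpace F o m (j + 1), T j x - T (j + 1) x ∈ (armSpace F o m j)ᗮ)
    (hout : ∀ j < m, ¬ o j → ∀ x ∈ armSpace F o m j,
      T (j + 1) x - T j x ∈ (armSpace F o m (j + 1))ᗮ) {j : ℕ} (hj : j ≤ m) :
    (∀ k, k ≤ (armBounds o m j).1 ∨ (armBounds o m j).2 ≤ k → ∀ x ∈ F k, T 0 x ∈ F k) ∧
      ∀ u ∈ armSpace F o m j, T 0 u - T j u ∈ F (armBounds o m j).1 := by
  induction j with
  | zero =>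
    refine ⟨fun k hk x hx => ?_, fun u _ => by simp⟩
    rcases hk with hk | hk
    · have : k = 0 := by simpa [armBounds] using hk
      subst this
      rw [h0, Submodule.mem_bot] at hx ⊢
      rw [hx, map_zero]
    · refine hF hk ?_
      simp [armBounds, htop]
  | succ j ih =>
    obtain ⟨ih1, ih2⟩ := ih (by omega)
    have hadd := armBounds_add o m (show j ≤ m by omega)
    specialize hin j (by omega)
    specialize hout j (by omega)
    have hTj := hT j (by omega)
    have hTj1 := hT (j + 1) hj
    have hT'1 := hT' (j + 1) hj
    by_cases h : o j
    · replace hin := hin h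
      clear hout
      have hb : armBounds o m (j + 1) = ((armBounds o m j).1, (armBounds o m j).2 - 1) := by
        simp [armBounds, h]
      simp only [armSpace, hb] at *
      set l := (armBounds o m j).1
      set t := (armBounds o m j).2
      have hle : F (t - 1) ⊓ (F l)ᗮ ≤ F t ⊓ (F l)ᗮ := inf_le_inf_right _ (hF (by omega))
      have heq : ∀ x ∈ F (t - 1) ⊓ (F l)ᗮ, T j x = T (j + 1) x := fun x hx => by
        rw [← sub_eq_zero]
        exact (Submodule.orthogonal_disjoint _).le_bot
          ⟨sub_mem (hTj x) (hle (hTj1 x)), hin x hx⟩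
      refine ⟨fun k hk x hx => ?_, fun u hu => by rw [← heq u hu]; exact ih2 u (hle hu)⟩
      by_cases hk' : k ≤ l ∨ t ≤ k
      · exact ih1 k hk' x hx
      have hk1 : k = t - 1 := by omega
      subst hk1
      have hlt : F l ≤ F (t - 1) := hF (by omega)
      obtain ⟨y, hy, u, hu, rfl⟩ := Submodule.exists_add_of_le hlt hx
      have h1 := ih2 u (hle hu)
      rw [heq u hu] at h1
      have h2 : T 0 (y + u) = T 0 y + (T 0 u - T (j + 1) u) + T (j + 1) u := by
        rw [map_add]; abel
      rw [h2]
      exact add_mem (add_mem (hlt (ih1 l (Or.inl le_rfl) y hy)) (hlt h1)) (hTj1 u).1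
    · replace hout := hout h
      clear hin
      have hb : armBounds o m (j + 1) = ((armBounds o m j).1 + 1, (armBounds o m j).2) := by
        simp [armBounds, h]
      simp only [armSpace, hb] at *
      set l := (armBounds o m j).1
      set t := (armBounds o m j).2
      have hl : F l ≤ F (l + 1) := hF (by omega)
      have hlt : F (l + 1) ≤ F t := hF (by omega)
      have hle : F t ⊓ (F (l + 1))ᗮ ≤ F t ⊓ (F l)ᗮ :=
        inf_le_inf_left _ (Submodule.orthogonal_le hl)
      -- The difference is the component of `T j x` orthogonal to the next layer.
      have hdiff : ∀ x ∈ F t ⊓ (F l)ᗮ, T j x - T (j + 1) x ∈ F (l + 1) := fun x hx => by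
        obtain ⟨y, hy, u, hu, hyu⟩ := Submodule.exists_add_of_le hlt
          (sub_mem (hTj x).1 (hTj1 x).1)
        have hu' : u ∈ (F t ⊓ (F (l + 1))ᗮ)ᗮ := by
          have h3 : u = -(T (j + 1) x - T j x) - y := by rw [neg_sub, hyu]; abel
          rw [h3]
          exact sub_mem (neg_mem (hout x hx))
            (Submodule.orthogonal_le inf_le_right ((F (l + 1)).le_orthogonal_orthogonal hy))
        have : u = 0 := (Submodule.orthogonal_disjoint _).le_bot ⟨hu, hu'⟩
        rw [hyu, this, add_zero]
        exact hy
      refine ⟨fun k hk x hx => ?_, fun u hu => ?_⟩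
      · by_cases hk' : k ≤ l ∨ t ≤ k
        · exact ih1 k hk' x hx
        have hk1 : k = l + 1 := by omega
        subst hk1
        obtain ⟨y, hy, u, hu, rfl⟩ := Submodule.exists_add_of_le hl hx
        have hu2 : u ∈ F t ⊓ (F l)ᗮ := ⟨hlt hu.1, hu.2⟩
        have h1 := hdiff u hu2
        rw [hT'1 u (Submodule.orthogonal_le inf_le_right
          ((F (l + 1)).le_orthogonal_orthogonal hu.1)), sub_zero] at h1
        have h2 : T 0 (y + u) = T 0 y + (T 0 u - T j u) + T j u := by
          rw [map_add]; abel
        rw [h2]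
        exact add_mem (add_mem (hl (ih1 l (Or.inl le_rfl) y hy)) (hl (ih2 u hu2))) h1
      · have h2 : T 0 u - T (j + 1) u = (T 0 u - T j u) + (T j u - T (j + 1) u) := by abel
        rw [h2]
        exact add_mem (hl (ih2 u (hle hu))) (hdiff u (hle hu))

end Arm

/-- A flag of closed subspaces of `E` with `len` members between `⊥` and `⊤`. -/
structure ClosedFlag (E : Type w) [NormedAddCommGroup E] [InnerProductSpace ℂ E] where
  len : ℕ
  space : ℕ → Submodule ℂ E
  monotone : Monotone space
  isClosed : ∀ k, IsClosed (space k : Set E)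
  space_zero : space 0 = ⊥
  space_top : space (len + 1) = ⊤

/-- The only idempotent operators preserving all members of the flags `S i` are `0` and `1`. -/
def HasTrivialIdempotents {E : Type w} [NormedAddCommGroup E] [InnerProductSpace ℂ E] {n : ℕ}
    (S : Fin n → ClosedFlag E) : Prop :=
  ∀ T : E →ₗ[ℂ] E, (∀ x, T (T x) = T x) → (∀ i k, ∀ x ∈ (S i).space k, T x ∈ (S i).space k) →
    T = 0 ∨ T = LinearMap.id

namespace HilbertRep

variable {V : Type u} [Quiver.{v + 1} V]

/-- A quiver with a connected set `core` of vertices and, attached to it, disjoint arms of the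
lengths of the flags has an indecomposable representation by layers of the flags. The vertices
outside `core` and the arms carry `0`, and other arrows only restrict the endomorphisms further. -/
theorem exists_indecomposable_of_flags {E : Type w} [NormedAddCommGroup E]
    [InnerProductSpace ℂ E] [CompleteSpace E] [TopologicalSpace.SeparableSpace E]
    (hE : ¬ FiniteDimensional ℂ E) {n : ℕ} (S : Fin n → ClosedFlag E)
    (hS : HasTrivialIdempotents S)
    (core : Set V) (c : V) (hc : c ∈ core)
    (hcore : ∀ a ∈ core, Relation.EqvGen
      (fun a b : V => a ∈ core ∧ b ∈ core ∧ Nonempty (a ⟶ b)) c a)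
    (x : Fin n → ℕ → V) (hx0 : ∀ i, x i 0 ∈ core)
    (hx : ∀ i j, 1 ≤ j → j ≤ (S i).len → x i j ∉ core)
    (hinj : ∀ i j i' j', 1 ≤ j → j ≤ (S i).len → 1 ≤ j' → j' ≤ (S i').len → x i j = x i' j' →
      i = i' ∧ j = j')
    (harr : ∀ i, ∀ j < (S i).len, Nonempty (x i (j + 1) ⟶ x i j) ∨ Nonempty (x i j ⟶ x i (j + 1))) :
    ∃ R : HilbertRep.{u, v, w} V,
      R.IsSeparable ∧ R.IsInfiniteDimensional ∧ R.IsIndecomposable := by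
  classical
  have hcomp : ∀ i k, CompleteSpace ((S i).space k) := fun i k =>
    ((S i).isClosed k).completeSpace_coe
  let o : Fin n → ℕ → Prop := fun i j => Nonempty (x i (j + 1) ⟶ x i j)
  let A : Fin n → ℕ → Submodule ℂ E := fun i j => armSpace ((S i).space) (o i) ((S i).len) j
  have hA0 : ∀ i, A i 0 = ⊤ := fun i => armSpace_zero ((S i).space_zero) ((S i).space_top) _
  let onArm : V → Fin n × ℕ → Prop := fun a p => 1 ≤ p.2 ∧ p.2 ≤ (S p.1).len ∧ x p.1 p.2 = a
  let U : V → Submodule ℂ E := fun a =>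
    if a ∈ core then ⊤ else if h : ∃ p, onArm a p then A h.choose.1 h.choose.2 else ⊥
  have hUcore : ∀ a ∈ core, U a = ⊤ := fun a ha => if_pos ha
  have hUx : ∀ i j, j ≤ (S i).len → U (x i j) = A i j := by
    intro i j hj
    rcases Nat.eq_zero_or_pos j with rfl | hj0
    · rw [hUcore _ (hx0 i), hA0]
    have h : ∃ p, onArm (x i j) p := ⟨(i, j), hj0, hj, rfl⟩
    have hU : U (x i j) = A h.choose.1 h.choose.2 := by
      simp only [U, if_neg (hx i j hj0 hj), dif_pos h]
    obtain ⟨h1, h2, h3⟩ := h.choose_spec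
    obtain ⟨h4, h5⟩ := hinj _ _ _ _ h1 h2 hj0 hj h3
    rw [hU, h4, h5]
  have hU0 : ∀ a, a ∉ core → (¬ ∃ i j, 1 ≤ j ∧ j ≤ (S i).len ∧ x i j = a) → U a = ⊥ := by
    intro a ha h
    have h' : ¬ ∃ p, onArm a p := fun ⟨p, hp⟩ => h ⟨p.1, p.2, hp⟩
    simp only [U, if_neg ha, dif_neg h']
  have hUcomp : ∀ a, CompleteSpace (U a) := by
    intro a
    have hA : ∀ i j, CompleteSpace (A i j) := fun i j =>
      (((S i).isClosed _).inter (Submodule.isClosed_orthogonal _)).completeSpace_coe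
    by_cases ha : a ∈ core
    · rw [hUcore a ha]
      exact (isClosed_univ (X := E)).completeSpace_coe
    by_cases h : ∃ i j, 1 ≤ j ∧ j ≤ (S i).len ∧ x i j = a
    · obtain ⟨i, j, -, hj, rfl⟩ := h
      rw [hUx i j hj]
      exact hA i j
    · rw [hU0 a ha h]
      infer_instance
  have hntE : Nontrivial E := by
    by_contra h
    rw [not_nontrivial_iff_subsingleton] at h
    exact hE inferInstance
  refine ⟨subspaceRep U, fun a => ?_, ⟨c, fun h => hE ?_⟩, fun h => ?_, fun hd => ?_⟩
  · have := UniformSpace.secondCountable_of_separable E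
    change TopologicalSpace.SeparableSpace (U a)
    infer_instance
  · change FiniteDimensional ℂ (U c) at h
    rw [hUcore c hc] at h
    exact Module.Finite.equiv (Submodule.topEquiv (R := ℂ) (M := E))
  · have h1 : Subsingleton (U c) := h c
    rw [hUcore c hc] at h1
    exact not_subsingleton E (Submodule.topEquiv (R := ℂ) (M := E)).symm.toEquiv.subsingleton
  · obtain ⟨T, hTU, hT0, hTT, hTf, ⟨a₀, ξ, hξU, hξ⟩, b₀, η, hηU, hη⟩ :=
      exists_idempotent_of_subspaceRep_isDecomposable hd
    have hconst : ∀ a ∈ core, T c = T a := by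
      intro a ha
      replace ha := hcore a ha
      clear * - ha hTf hUcore
      induction ha with
      | rel a b h =>
        obtain ⟨ha, hb, ⟨e⟩⟩ := h
        refine LinearMap.ext fun y => ?_
        have := hTf e y (by rw [hUcore a ha]; trivial)
        rw [hUcore b hb, Submodule.top_orthogonal_eq_bot, Submodule.mem_bot, sub_eq_zero] at this
        exact this.symm
      | refl a => rfl
      | symm a b _ ih => exact ih.symm
      | trans a b c _ _ ih₁ ih₂ => exact ih₁.trans ih₂
    have harm : ∀ i j, j ≤ (S i).len → _ := fun i j hj =>
      arm_invariant (m := (S i).len) (S i).monotone (S i).space_zero (S i).space_top (o := o i)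
        (T := fun j => T (x i j)) (fun j hj y => by
          have := hTU (x i j) y
          rwa [hUx i j hj] at this)
        (fun j hj y hy => hT0 (x i j) y (by rwa [hUx i j hj]))
        (fun j hj ho y hy => by
          obtain ⟨e⟩ := ho
          have := hTf e y (by rwa [hUx i _ hj])
          rwa [hUx i j hj.le] at this)
        (fun j hj ho y hy => by
          obtain ⟨e⟩ := (harr i j hj).resolve_left ho
          have := hTf e y (by rwa [hUx i _ hj.le])
          rwa [hUx i _ hj] at this) hj
    have hflag : ∀ i k, ∀ y ∈ (S i).space k, T c y ∈ (S i).space k := by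
      intro i k y hy
      have := (harm i ((S i).len) le_rfl).1 k (by
        have := armBounds_add (o i) ((S i).len) (le_refl ((S i).len))
        omega) y hy
      rwa [hconst _ (hx0 i)]
    -- The endomorphism is determined by its component `T c` on the core.
    have hdet : ∀ s : ℂ, T c = s • LinearMap.id → ∀ a, ∀ y ∈ U a, T a y = s • y := by
      intro s hs a y hy
      by_cases ha : a ∈ core
      · rw [← hconst a ha, hs]; rfl
      by_cases h : ∃ i j, 1 ≤ j ∧ j ≤ (S i).len ∧ x i j = a
      · obtain ⟨i, j, -, hj, rfl⟩ := h
        have hTy := hTU (x i j) y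
        rw [hUx i j hj] at hy hTy
        have h1 := (harm i j hj).2 y hy
        change T (x i 0) y - T (x i j) y ∈ _ at h1
        rw [← hconst _ (hx0 i), hs] at h1
        have h2 : s • y - T (x i j) y ∈ A i j := sub_mem (Submodule.smul_mem _ _ hy) hTy
        exact (sub_eq_zero.1 ((Submodule.orthogonal_disjoint _).le_bot ⟨h1, h2.2⟩)).symm
      · rw [hU0 a ha h, Submodule.mem_bot] at hy
        rw [hy, map_zero, smul_zero]
    rcases hS (T c) (hTT c) hflag with h | h
    · exact hξ (by rw [hdet 0 (by rw [h, zero_smul]) a₀ ξ hξU, zero_smul])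
    · exact hη (by rw [hdet 1 (by rw [h, one_smul]) b₀ η hηU, one_smul])

end HilbertRep

/-! ### Four systems of flags -/

namespace ClosedFlag

/-- The flag with the single intermediate member `W`. -/
def ofSubspace {E : Type w} [NormedAddCommGroup E] [InnerProductSpace ℂ E] (W : Submodule ℂ E)
    (hW : IsClosed (W : Set E)) : ClosedFlag E where
  len := 1
  space k := match k with
    | 0 => ⊥
    | 1 => W
    | _ => ⊤
  monotone := monotone_nat_of_le_succ fun k => by
    rcases k with _ | _ | k
    exacts [bot_le, le_top, le_rfl]
  isClosed k := by
    rcases k with _ | _ | k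
    exacts [isClosed_singleton, hW, isClosed_univ]
  space_zero := rfl
  space_top := rfl

/-- The flag with the intermediate members `L ≤ M`. -/
def ofSubspaces {E : Type w} [NormedAddCommGroup E] [InnerProductSpace ℂ E] (L M : Submodule ℂ E)
    (hL : IsClosed (L : Set E)) (hM : IsClosed (M : Set E)) (h : L ≤ M) : ClosedFlag E where
  len := 2
  space k := match k with
    | 0 => ⊥
    | 1 => L
    | 2 => M
    | _ => ⊤
  monotone := monotone_nat_of_le_succ fun k => by
    rcases k with _ | _ | _ | k
    exacts [bot_le, h, le_top, le_rfl]
  isClosed k := by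
    rcases k with _ | _ | _ | k
    exacts [isClosed_singleton, hL, hM, isClosed_univ]
  space_zero := rfl
  space_top := rfl

end ClosedFlag

namespace ShiftSpace

/-- The direct sum of `n` copies of `ℓ²(ℕ)`. -/
abbrev Power (n : ℕ) : Type w := PiLp 2 fun _ : Fin n => ShiftSpace.{w}

/-- The `i`-th coordinate. -/
noncomputable abbrev coord {n : ℕ} (i : Fin n) : Power.{w} n →L[ℂ] ShiftSpace.{w} :=
  PiLp.proj 2 (fun _ : Fin n => ShiftSpace.{w}) i

/-- The inclusion of the `i`-th summand. -/
noncomputable def incl {n : ℕ} (i : Fin n) : ShiftSpace.{w} →ₗ[ℂ] Power.{w} n :=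
  (WithLp.linearEquiv 2 ℂ (Fin n → ShiftSpace.{w})).symm.toLinearMap ∘ₗ
    LinearMap.single ℂ (fun _ : Fin n => ShiftSpace.{w}) i

theorem incl_apply {n : ℕ} (i j : Fin n) (x : ShiftSpace.{w}) :
    incl i x j = if j = i then x else 0 := by
  simp [incl]

theorem sum_incl {n : ℕ} (y : Power.{w} n) : ∑ j, incl j (y j) = y := by
  ext1 i
  simp [incl_apply]

theorem power_not_finiteDimensional {n : ℕ} (i : Fin n) :
    ¬ FiniteDimensional ℂ (Power.{w} n) := fun _ =>
  not_finiteDimensional (Module.Finite.of_surjective (coord.{w} i).toLinearMap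
    fun x => ⟨incl i x, by simp [incl_apply]⟩)

/-- The entry with indices `i`, `j` of a linear map, viewed as a matrix of operators. -/
noncomputable def entry {n : ℕ} (T : Power.{w} n →ₗ[ℂ] Power.{w} n) (i j : Fin n) :
    ShiftSpace.{w} →ₗ[ℂ] ShiftSpace.{w} :=
  (coord i).toLinearMap ∘ₗ T ∘ₗ incl j

theorem apply_eq_sum_entry {n : ℕ} (T : Power.{w} n →ₗ[ℂ] Power.{w} n) (y : Power.{w} n)
    (i : Fin n) : T y i = ∑ j, entry T i j (y j) := by
  conv_lhs => rw [← sum_incl y, map_sum]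
  simp [entry]

/-- The subspace where the coordinates in `s` vanish. -/
noncomputable def vanishing {n : ℕ} (s : Set (Fin n)) : Submodule ℂ (Power.{w} n) :=
  ⨅ i ∈ s, LinearMap.ker (coord.{w} i).toLinearMap

theorem mem_vanishing {n : ℕ} {s : Set (Fin n)} {y : Power.{w} n} :
    y ∈ vanishing s ↔ ∀ i ∈ s, y i = 0 := by
  simp [vanishing]

theorem entry_eq_zero {n : ℕ} {T : Power.{w} n →ₗ[ℂ] Power.{w} n} {s : Set (Fin n)}
    (h : ∀ y ∈ vanishing s, T y ∈ vanishing s) {i j : Fin n} (hi : i ∈ s) (hj : j ∉ s) :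
    entry T i j = 0 := by
  ext1 x
  refine mem_vanishing.1 (h (incl j x) (mem_vanishing.2 fun k hk => ?_)) i hi
  rw [incl_apply, if_neg (ne_of_mem_of_not_mem hk hj)]

/-- A flag of coordinate subspaces; the `k`-th one is given by the vanishing of the coordinates
in `s k`. -/
noncomputable def coordFlag {n : ℕ} (m : ℕ) (s : ℕ → Set (Fin n)) (hs : Antitone s)
    (h0 : s 0 = Set.univ) (htop : s (m + 1) = ∅) : ClosedFlag (Power.{w} n) where
  len := m
  space k := vanishing (s k)
  monotone _ _ hkl _ hy := mem_vanishing.2 fun i hi => mem_vanishing.1 hy i (hs hkl hi)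
  isClosed k := by
    simp only [vanishing, Submodule.coe_iInf]
    exact isClosed_iInter fun i => isClosed_iInter fun _ => (coord.{w} i).isClosed_ker
  space_zero := by
    refine (Submodule.eq_bot_iff _).2 fun y hy => ?_
    ext1 i
    exact mem_vanishing.1 hy i (h0 ▸ Set.mem_univ i)
  space_top := by
    refine Submodule.eq_top_iff'.2 fun y => mem_vanishing.2 fun i hi => ?_
    rw [htop] at hi
    exact hi.elim

/-- The standard flag of the spans of the first `k` summands. -/
noncomputable def stdFlag (m : ℕ) : ClosedFlag (Power.{w} (m + 1)) :=
  coordFlag m (fun k => {i | k ≤ i.val}) (fun _ _ hkl _ hi => hkl.trans hi)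
    (by simp) (by ext i; simp; omega)

/-- The flag of the spans of the last `d * k` summands. -/
noncomputable def oppFlag (d m : ℕ) : ClosedFlag (Power.{w} (d * (m + 1))) :=
  coordFlag m (fun k => {i | i.val + d * k < d * (m + 1)})
    (fun _ _ hkl _ hi => (Nat.add_le_add_left (Nat.mul_le_mul_left d hkl) _).trans_lt hi)
    (by ext i; simp) (by ext i; simp)

/-- An idempotent that acts on every summand by one operator commuting with the shift is
trivial. -/
theorem eq_zero_or_eq_id_of_apply_eq {n : ℕ} (i : Fin n) {T : Power.{w} n →ₗ[ℂ] Power.{w} n}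
    (hTT : ∀ y, T (T y) = T y) {A : ShiftSpace.{w} →ₗ[ℂ] ShiftSpace.{w}}
    (hT : ∀ y j, T y j = A (y j)) (hA : ∀ x, A (shift x) = shift (A x)) :
    T = 0 ∨ T = LinearMap.id := by
  have hAA : ∀ x, A (A x) = A x := fun x => by
    have := congrArg (fun y => y i) (hTT (incl i x))
    simpa [hT, incl_apply] using this
  rcases eq_zero_or_eq_id_of_idempotent hAA hA with rfl | rfl
  · left
    ext1 y
    ext1 j
    exact hT y j
  · right
    ext1 y
    ext1 j
    exact hT y j

/-- Flags of the type of the extended Dynkin diagram `D₄`: four subspaces of the sum of two copies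
of `ℓ²(ℕ)`, namely both summands, the diagonal and the graph of the shift. -/
noncomputable def flagsD : Fin 4 → ClosedFlag (Power.{w} 2) :=
  ![stdFlag 1, oppFlag 1 1,
    .ofSubspace (LinearMap.ker (coord 1 - coord 0).toLinearMap)
      (ContinuousLinearMap.isClosed_ker _),
    .ofSubspace (LinearMap.ker (coord 1 - shift ∘L coord 0).toLinearMap)
      (ContinuousLinearMap.isClosed_ker _)]

theorem flagsD_hasTrivialIdempotents : HasTrivialIdempotents flagsD.{w} := by
  intro T hTT hT
  have h10 : entry T 1 0 = 0 := entry_eq_zero (hT 0 1) (by simp) (by simp)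
  have h01 : entry T 0 1 = 0 := entry_eq_zero (hT 1 1) (by simp) (by simp)
  have hTy := apply_eq_sum_entry T
  simp only [Fin.sum_univ_two] at hTy
  have h2 := hT 2 1
  have h3 := hT 3 1
  simp only [flagsD, ClosedFlag.ofSubspace, Matrix.cons_val, LinearMap.mem_ker] at h2 h3
  have e2 : ∀ x, entry T 1 1 x = entry T 0 0 x := fun x => by
    have := h2 (WithLp.toLp 2 ![x, x]) (by simp)
    simpa [hTy, h10, h01, sub_eq_zero] using this
  have e3 : ∀ x, entry T 1 1 (shift x) = shift (entry T 0 0 x) := fun x => by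
    have := h3 (WithLp.toLp 2 ![x, shift x]) (by simp)
    simpa [hTy, h10, h01, sub_eq_zero] using this
  refine eq_zero_or_eq_id_of_apply_eq 0 hTT (A := entry T 0 0) (fun y j => ?_)
    fun x => by rw [← e2, e3]
  fin_cases j <;> simp [hTy, h10, h01, e2]

/-- Flags of the type of the extended Dynkin diagram `E₆`: two opposite complete flags of the sum of
three copies of `ℓ²(ℕ)`, and a line in a plane that depends on the shift. -/
noncomputable def flagsE₆ : Fin 3 → ClosedFlag (Power.{w} 3) :=
  ![stdFlag 2, oppFlag 1 2,
    .ofSubspaces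
      (LinearMap.ker (coord 1 - coord 0).toLinearMap ⊓
        LinearMap.ker (coord 2 - coord 0).toLinearMap)
      (LinearMap.ker (coord 2 - coord 0 - shift ∘L (coord 1 - coord 0)).toLinearMap)
      ((ContinuousLinearMap.isClosed_ker _).inter (ContinuousLinearMap.isClosed_ker _))
      (ContinuousLinearMap.isClosed_ker _) (fun y hy => by
        have h1 : coord 1 y - coord 0 y = 0 := hy.1
        have h2 : coord 2 y - coord 0 y = 0 := hy.2
        change coord 2 y - coord 0 y - shift (coord 1 y - coord 0 y) = 0
        rw [h1, h2, map_zero, sub_zero])]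

theorem flagsE₆_hasTrivialIdempotents : HasTrivialIdempotents flagsE₆.{w} := by
  intro T hTT hT
  have h10 : entry T 1 0 = 0 := entry_eq_zero (hT 0 1) (by simp) (by simp)
  have h20 : entry T 2 0 = 0 := entry_eq_zero (hT 0 1) (by simp) (by simp)
  have h21 : entry T 2 1 = 0 := entry_eq_zero (hT 0 2) (by simp) (by simp)
  have h01 : entry T 0 1 = 0 := entry_eq_zero (hT 1 2) (by simp) (by simp)
  have h02 : entry T 0 2 = 0 := entry_eq_zero (hT 1 1) (by simp) (by simp)
  have h12 : entry T 1 2 = 0 := entry_eq_zero (hT 1 1) (by simp) (by simp)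
  have hTy := apply_eq_sum_entry T
  simp only [Fin.sum_univ_three] at hTy
  have hL := hT 2 1
  have hM := hT 2 2
  simp only [flagsE₆, ClosedFlag.ofSubspaces, Matrix.cons_val, Submodule.mem_inf,
    LinearMap.mem_ker] at hL hM
  have e : ∀ x, entry T 1 1 x = entry T 0 0 x ∧ entry T 2 2 x = entry T 0 0 x := fun x => by
    have := hL (WithLp.toLp 2 ![x, x, x]) (by simp)
    simpa [hTy, h10, h20, h21, h01, h02, h12, sub_eq_zero] using this
  have e' : ∀ x, entry T 2 2 (shift x) = shift (entry T 1 1 x) := fun x => by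
    have := hM (WithLp.toLp 2 ![0, x, shift x]) (by simp)
    simpa [hTy, h10, h20, h21, h01, h02, h12, sub_eq_zero] using this
  refine eq_zero_or_eq_id_of_apply_eq 0 hTT (A := entry T 0 0) (fun y j => ?_)
    fun x => by rw [← (e _).2, e', (e _).1]
  fin_cases j <;> simp [hTy, h10, h20, h21, h01, h02, h12, e]

/-- Flags of the type of the extended Dynkin diagram `E₇`: a subspace of the sum of four copies
of `ℓ²(ℕ)`, the graph of an operator from the first two to the last two summands, and two opposite
complete flags. -/
noncomputable def flagsE₇ : Fin 3 → ClosedFlag (Power.{w} 4) :=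
  ![.ofSubspace
      (LinearMap.ker (coord 2 - coord 0 - coord 1).toLinearMap ⊓
        LinearMap.ker (coord 3 - coord 0 - shift ∘L coord 1).toLinearMap)
      ((ContinuousLinearMap.isClosed_ker _).inter (ContinuousLinearMap.isClosed_ker _)),
    stdFlag 3, oppFlag 1 3]

theorem flagsE₇_hasTrivialIdempotents : HasTrivialIdempotents flagsE₇.{w} := by
  intro T hTT hT
  have h10 : entry T 1 0 = 0 := entry_eq_zero (hT 1 1) (by simp) (by simp)
  have h20 : entry T 2 0 = 0 := entry_eq_zero (hT 1 1) (by simp) (by simp)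
  have h30 : entry T 3 0 = 0 := entry_eq_zero (hT 1 1) (by simp) (by simp)
  have h21 : entry T 2 1 = 0 := entry_eq_zero (hT 1 2) (by simp) (by simp)
  have h31 : entry T 3 1 = 0 := entry_eq_zero (hT 1 2) (by simp) (by simp)
  have h32 : entry T 3 2 = 0 := entry_eq_zero (hT 1 3) (by simp) (by simp)
  have h01 : entry T 0 1 = 0 := entry_eq_zero (hT 2 3) (by simp) (by simp)
  have h02 : entry T 0 2 = 0 := entry_eq_zero (hT 2 2) (by simp) (by simp)
  have h12 : entry T 1 2 = 0 := entry_eq_zero (hT 2 2) (by simp) (by simp)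
  have h03 : entry T 0 3 = 0 := entry_eq_zero (hT 2 1) (by simp) (by simp)
  have h13 : entry T 1 3 = 0 := entry_eq_zero (hT 2 1) (by simp) (by simp)
  have h23 : entry T 2 3 = 0 := entry_eq_zero (hT 2 1) (by simp) (by simp)
  have hTy := apply_eq_sum_entry T
  simp only [Fin.sum_univ_four] at hTy
  have hW := hT 0 1
  simp only [flagsE₇, ClosedFlag.ofSubspace, Matrix.cons_val, Submodule.mem_inf,
    LinearMap.mem_ker] at hW
  have e : ∀ x, entry T 2 2 x = entry T 0 0 x ∧ entry T 3 3 x = entry T 0 0 x := fun x => by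
    have := hW (WithLp.toLp 2 ![x, 0, x, x]) (by simp)
    simpa [hTy, h10, h20, h21, h01, h02, h12, h30, h31, h32, h03, h13, h23, sub_eq_zero] using this
  have e' : ∀ x, entry T 2 2 x = entry T 1 1 x ∧ entry T 3 3 (shift x) = shift (entry T 1 1 x) :=
    fun x => by
      have := hW (WithLp.toLp 2 ![0, x, x, shift x]) (by simp)
      simpa [hTy, h10, h20, h21, h01, h02, h12, h30, h31, h32, h03, h13, h23, sub_eq_zero]
        using this
  refine eq_zero_or_eq_id_of_apply_eq 0 hTT (A := entry T 0 0) (fun y j => ?_)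
    fun x => by rw [← (e _).2, (e' _).2, ← (e' _).1, (e _).1]
  fin_cases j <;>
    simp [hTy, h10, h20, h21, h01, h02, h12, h30, h31, h32, h03, h13, h23, e, ← e']

/-- Flags of the type of the extended Dynkin diagram `E₈`. Let `W` be a sum of three copies of
`ℓ²(ℕ)` with three flags of type `E₆`, and embed `W` in the sum of the three quotients of `W` by the
lines of the flags; it consists of the vectors `(y, z, y, x, y - x, z - x - S (y - x))`. The
standard and the opposite flag together single out the three quotients, which are the sums of two consecutive
summands, and in each of them the first summand, which is the image of the plane of a flag. -/
noncomputable def flagsE₈ : Fin 3 → ClosedFlag (Power.{w} 6) :=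
  ![.ofSubspace
      (LinearMap.ker (coord 2 - coord 0).toLinearMap ⊓
        (LinearMap.ker (coord 4 - (coord 2 - coord 3)).toLinearMap ⊓
        LinearMap.ker (coord 5 - (coord 1 - coord 3 - shift ∘L coord 4)).toLinearMap))
      ((ContinuousLinearMap.isClosed_ker _).inter
        ((ContinuousLinearMap.isClosed_ker _).inter (ContinuousLinearMap.isClosed_ker _))),
    oppFlag 2 2, stdFlag 5]

theorem flagsE₈_hasTrivialIdempotents : HasTrivialIdempotents flagsE₈.{w} := by
  intro T hTT hT
  -- Below the diagonal, the entries vanish because `T` preserves the standard flag.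
  have hlow : ∀ i j : Fin 6, j < i → entry T i j = 0 := fun i j h =>
    entry_eq_zero (hT 2 (j + 1)) (show j.val + 1 ≤ i.val from h) (by simp)
  have hopp : ∀ (k : ℕ) (i j : Fin 6), i.val + 2 * k < 6 → 6 ≤ j.val + 2 * k → entry T i j = 0 :=
    fun k i j hi hj => entry_eq_zero (hT 1 k) (show i.val + 2 * k < 6 from hi)
      (show ¬ j.val + 2 * k < 6 by omega)
  have hTy := apply_eq_sum_entry T
  have h0 : ∀ y, T y 0 = entry T 0 0 (y 0) + entry T 0 1 (y 1) := fun y => by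
    simp [hTy, Fin.sum_univ_six, hopp 2 0 2, hopp 2 0 3, hopp 2 0 4, hopp 2 0 5]
  have h1 : ∀ y, T y 1 = entry T 1 1 (y 1) := fun y => by
    simp [hTy, Fin.sum_univ_six, hlow 1 0, hopp 2 1 2, hopp 2 1 3, hopp 2 1 4, hopp 2 1 5]
  have h2 : ∀ y, T y 2 = entry T 2 2 (y 2) + entry T 2 3 (y 3) := fun y => by
    simp [hTy, Fin.sum_univ_six, hlow 2 0, hlow 2 1, hopp 1 2 4, hopp 1 2 5]
  have h3 : ∀ y, T y 3 = entry T 3 3 (y 3) := fun y => by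
    simp [hTy, Fin.sum_univ_six, hlow 3 0, hlow 3 1, hlow 3 2, hopp 1 3 4, hopp 1 3 5]
  have h4 : ∀ y, T y 4 = entry T 4 4 (y 4) + entry T 4 5 (y 5) := fun y => by
    simp [hTy, Fin.sum_univ_six, hlow 4 0, hlow 4 1, hlow 4 2, hlow 4 3]
  have h5 : ∀ y, T y 5 = entry T 5 5 (y 5) := fun y => by
    simp [hTy, Fin.sum_univ_six, hlow 5 0, hlow 5 1, hlow 5 2, hlow 5 3, hlow 5 4]
  have hW := hT 0 1
  simp only [flagsE₈, ClosedFlag.ofSubspace, Matrix.cons_val, Submodule.mem_inf,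
    LinearMap.mem_ker] at hW
  -- Membership of `T w` in `W`, for vectors `w` of `W` with one non-zero parameter `z`, `y` or `x`.
  have ez : ∀ x, entry T 0 1 x = 0 ∧ entry T 4 5 x = 0 ∧
      entry T 5 5 x = entry T 1 1 x - shift (entry T 4 5 x) := fun x => by
    have := hW (WithLp.toLp 2 ![0, x, 0, 0, 0, x]) (by simp)
    simpa [h0, h1, h2, h3, h4, h5, sub_eq_zero] using this
  have h01 := fun x => (ez x).1
  have h45 := fun x => (ez x).2.1
  have h55 : ∀ x, entry T 5 5 x = entry T 1 1 x := fun x => by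
    rw [(ez x).2.2, h45, map_zero, sub_zero]
  have ey : ∀ x, entry T 2 2 x = entry T 0 0 x ∧ entry T 4 4 x = entry T 2 2 x ∧
      entry T 5 5 (shift x) = shift (entry T 4 4 x) := fun x => by
    have := hW (WithLp.toLp 2 ![x, 0, x, 0, x, -shift x]) (by simp)
    simpa [h0, h1, h2, h3, h4, h5, h45, sub_eq_zero, neg_add_eq_zero] using this
  have ex : ∀ x, entry T 2 3 x = 0 ∧ -entry T 4 4 x = entry T 2 3 x - entry T 3 3 x ∧
      -entry T 5 5 x + entry T 5 5 (shift x) = -entry T 3 3 x + shift (entry T 4 4 x) :=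
    fun x => by
      have := hW (WithLp.toLp 2 ![0, 0, 0, x, -x, -x + shift x]) (by simp)
      simpa [h0, h1, h2, h3, h4, h5, h45, sub_eq_zero] using this
  have h23 := fun x => (ex x).1
  have h44 : ∀ x, entry T 4 4 x = entry T 0 0 x := fun x => by rw [(ey x).2.1, (ey x).1]
  have h33 : ∀ x, entry T 3 3 x = entry T 0 0 x := fun x => by
    rw [← h44, ← neg_inj, (ex x).2.1, h23, zero_sub]
  have h55' : ∀ x, entry T 5 5 x = entry T 0 0 x := fun x => by
    have := (ex x).2.2
    rwa [(ey x).2.2, add_left_inj, neg_inj, h33] at this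
  refine eq_zero_or_eq_id_of_apply_eq 0 hTT (A := entry T 0 0) (fun y j => ?_)
    fun x => by rw [← h55', (ey x).2.2, h44]
  fin_cases j <;> simp [h0, h1, h2, h3, h4, h5, h01, h23, h45, h33, h44, h55', ← h55, (ey _).1]

end ShiftSpace

/-! ### Trees -/

namespace SimpleGraph

variable {V : Type*} {G : SimpleGraph V}

theorem Connected.exists_adj_dist_eq (hG : G.Connected) {c v : V} (hv : v ≠ c) :
    ∃ p, G.Adj v p ∧ G.dist c v = G.dist c p + 1 := by
  obtain ⟨q, hq⟩ := hG.exists_walk_length_eq_dist v c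
  cases q with
  | nil => exact absurd rfl hv
  | @cons _ p _ h q =>
    refine ⟨p, h, ?_⟩
    rw [G.dist_comm, G.dist_comm (u := c)]
    have h1 := G.dist_le q
    have h2 := hG.dist_triangle (u := v) (v := p) (w := c)
    rw [dist_eq_one_iff_adj.2 h] at h2
    rw [Walk.length_cons] at hq
    omega

theorem IsTree.eq_of_adj_of_dist_eq (hG : G.IsTree) {c v p q : V} (hp : G.Adj v p)
    (hq : G.Adj v q) (hdp : G.dist c v = G.dist c p + 1) (hdq : G.dist c v = G.dist c q + 1) :
    p = q := by
  classical
  have key : ∀ {p}, G.dist c v = G.dist c p + 1 → ∃ r : G.Walk c p, r.IsPath ∧ v ∉ r.support := by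
    intro p hdp
    obtain ⟨r, hr, hl⟩ := hG.connected.exists_path_of_dist c p
    refine ⟨r, hr, fun hv => ?_⟩
    have h1 := G.dist_le (r.takeUntil v hv)
    have h2 := r.length_takeUntil_le_length hv
    omega
  obtain ⟨r, hr, hvr⟩ := key hdp
  obtain ⟨s, hs, hvs⟩ := key hdq
  have h := (hG.existsUnique_path c v).unique (hr.concat hvr hp.symm) (hs.concat hvs hq.symm)
  have := congrArg Walk.penultimate h
  simpa using this

/-- Vertices other than `c` split into branches, named by their vertices adjacent to `c`. -/
theorem IsTree.exists_branch (hG : G.IsTree) (c : V) :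
    ∃ br : V → V, (∀ v, G.Adj c v → br v = v) ∧
      ∀ v p, p ≠ c → G.Adj v p → G.dist c v = G.dist c p + 1 → br v = br p := by
  classical
  have hpar : ∀ v, ∃ p, v ≠ c → G.Adj v p ∧ G.dist c v = G.dist c p + 1 := fun v => by
    by_cases hv : v = c
    · exact ⟨v, fun h => absurd hv h⟩
    · obtain ⟨p, hp⟩ := hG.connected.exists_adj_dist_eq hv
      exact ⟨p, fun _ => hp⟩
  choose par hpar using hpar
  refine ⟨fun v => par^[G.dist c v - 1] v, fun v hv => ?_, fun v p hp hvp hd => ?_⟩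
  · simp [dist_eq_one_iff_adj.2 hv]
  · have hv : v ≠ c := by
      rintro rfl
      simp at hd
    have hpv : par v = p := hG.eq_of_adj_of_dist_eq (hpar v hv).1 hvp (hpar v hv).2 hd
    have hpos := hG.connected.pos_dist_of_ne hp.symm
    obtain ⟨k, hk⟩ : ∃ k, G.dist c p = k + 1 := ⟨G.dist c p - 1, by omega⟩
    simp only [hd, hk, Nat.add_sub_cancel, Function.iterate_succ_apply, hpv]

/-- The graph `G` consists of the vertex `c` and `n` disjoint arms starting at it; the `i`-th arm
has the vertices `x i 1`, …, `x i (m i)`. -/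
structure IsSpider (G : SimpleGraph V) (c : V) {n : ℕ} (m : Fin n → ℕ) (x : Fin n → ℕ → V) :
    Prop where
  one_le : ∀ i, 1 ≤ m i
  zero : ∀ i, x i 0 = c
  exists_eq : ∀ v, v = c ∨ ∃ i j, 1 ≤ j ∧ j ≤ m i ∧ x i j = v
  inj : ∀ i j i' j', 1 ≤ j → j ≤ m i → 1 ≤ j' → j' ≤ m i' → x i j = x i' j' → i = i' ∧ j = j'
  ne : ∀ i j, 1 ≤ j → j ≤ m i → x i j ≠ c
  adj : ∀ i, ∀ j < m i, G.Adj (x i j) (x i (j + 1))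
  exists_adj : ∀ v w, G.Adj v w → ∃ i, ∃ j < m i,
    v = x i j ∧ w = x i (j + 1) ∨ w = x i j ∧ v = x i (j + 1)

theorem IsSpider.comp_perm {c : V} {n : ℕ} {m : Fin n → ℕ} {x : Fin n → ℕ → V}
    (h : G.IsSpider c m x) (σ : Equiv.Perm (Fin n)) :
    G.IsSpider c (m ∘ σ) (fun i => x (σ i)) where
  one_le i := h.one_le _
  zero i := h.zero _
  exists_eq v := (h.exists_eq v).imp id fun ⟨i, hi⟩ => ⟨σ.symm i, by simpa using hi⟩
  inj i j i' j' h1 h2 h3 h4 h5 := by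
    obtain ⟨h6, h7⟩ := h.inj _ _ _ _ h1 h2 h3 h4 h5
    exact ⟨σ.injective h6, h7⟩
  ne i j := h.ne _ _
  adj i j := h.adj _ _
  exists_adj v w hvw := by
    obtain ⟨i, hi⟩ := h.exists_adj v w hvw
    exact ⟨σ.symm i, by simpa using hi⟩

/-- A tree without branching outside `c` is a spider. The vertices of an arm are told apart by their
distances from `c`, since two of them at the same distance would lead to a branching vertex closer
to `c`. -/
theorem IsTree.exists_isSpider [Finite V] (hG : G.IsTree) {c : V}
    (hdeg : ∀ v ≠ c, ∀ x y z, G.Adj v x → G.Adj v y → G.Adj v z → x = y ∨ x = z ∨ y = z)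
    {n : ℕ} {a : Fin n → V} (ha : Function.Injective a) (hca : ∀ v, G.Adj c v ↔ ∃ i, a i = v) :
    ∃ (m : Fin n → ℕ) (x : Fin n → ℕ → V), Monotone m ∧ G.IsSpider c m x := by
  classical
  suffices h : ∃ (m : Fin n → ℕ) (x : Fin n → ℕ → V), G.IsSpider c m x by
    obtain ⟨m, x, h⟩ := h
    exact ⟨_, _, Tuple.monotone_sort m, h.comp_perm (Tuple.sort m)⟩
  obtain ⟨br, hbr1, hbr⟩ := hG.exists_branch c
  have hpos : ∀ {v}, v ≠ c → 0 < G.dist c v := fun hv => hG.connected.pos_dist_of_ne hv.symm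
  have hne : ∀ {v}, 0 < G.dist c v → v ≠ c := by
    rintro v hv rfl
    simp at hv
  have hbradj : ∀ k v, G.dist c v = k + 1 → G.Adj c (br v) := by
    intro k
    induction k with
    | zero =>
      intro v hv
      rw [zero_add, dist_eq_one_iff_adj] at hv
      rwa [hbr1 v hv]
    | succ k ih =>
      intro v hv
      obtain ⟨p, hvp, hd⟩ := hG.connected.exists_adj_dist_eq (hne (v := v) (by omega))
      rw [hbr v p (hne (by omega)) hvp hd]
      exact ih p (by omega)
  have hinj : ∀ k v w, G.dist c v = k + 1 → G.dist c w = k + 1 → br v = br w → v = w := by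
    intro k
    induction k with
    | zero =>
      intro v w hv hw h
      rw [zero_add, dist_eq_one_iff_adj] at hv hw
      rwa [hbr1 v hv, hbr1 w hw] at h
    | succ k ih =>
      intro v w hv hw h
      obtain ⟨p, hvp, hd⟩ := hG.connected.exists_adj_dist_eq (hne (v := v) (by omega))
      obtain ⟨q, hwq, hd'⟩ := hG.connected.exists_adj_dist_eq (hne (v := w) (by omega))
      have hpc : p ≠ c := hne (by omega)
      rw [hbr v p hpc hvp hd, hbr w q (hne (by omega)) hwq hd'] at h
      obtain rfl := ih p q (by omega) (by omega) h
      obtain ⟨r, hpr, hd''⟩ := hG.connected.exists_adj_dist_eq hpc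
      rcases hdeg p hpc v w r hvp.symm hwq.symm hpr with h | h | h
      · exact h
      · subst h; omega
      · subst h; omega
  have harm : ∀ i, ∃ (m : ℕ) (x : ℕ → V), 1 ≤ m ∧ x 0 = c ∧
      (∀ j, 1 ≤ j → j ≤ m → br (x j) = a i ∧ G.dist c (x j) = j) ∧
      ∀ v, v ≠ c → br v = a i → G.dist c v ≤ m := by
    intro i
    have hai : G.Adj c (a i) := (hca _).2 ⟨i, rfl⟩
    obtain ⟨v, ⟨hvc, hv⟩, hmax⟩ := Set.exists_max_image {v | v ≠ c ∧ br v = a i} (G.dist c)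
      (Set.toFinite _) ⟨a i, hai.ne', hbr1 _ hai⟩
    -- Going back from the vertex `v` farthest from `c` meets every smaller distance.
    have hex : ∀ k j, 1 ≤ j → j + k = G.dist c v → ∃ w, br w = a i ∧ G.dist c w = j := by
      intro k
      induction k with
      | zero => exact fun j _ hj => ⟨v, hv, by omega⟩
      | succ k ih =>
        intro j hj1 hj
        obtain ⟨w, hw, hd⟩ := ih (j + 1) (by omega) (by omega)
        obtain ⟨p, hwp, hdp⟩ := hG.connected.exists_adj_dist_eq (hne (v := w) (by omega))
        exact ⟨p, by rw [← hw, hbr w p (hne (by omega)) hwp hdp], by omega⟩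
    have hex' : ∀ j, ∃ w, (j = 0 → w = c) ∧
        (1 ≤ j → j ≤ G.dist c v → br w = a i ∧ G.dist c w = j) := by
      intro j
      by_cases hj : 1 ≤ j ∧ j ≤ G.dist c v
      · obtain ⟨w, hw⟩ := hex (G.dist c v - j) j hj.1 (by omega)
        exact ⟨w, by omega, fun _ _ => hw⟩
      · exact ⟨c, fun _ => rfl, fun h1 h2 => absurd ⟨h1, h2⟩ hj⟩
    choose x hx0 hx using hex'
    exact ⟨G.dist c v, x, hpos hvc, hx0 0 rfl, hx, fun w hwc hw => hmax w ⟨hwc, hw⟩⟩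
  choose m x hm hx0 hx hmax using harm
  have hxne : ∀ i j, 1 ≤ j → j ≤ m i → x i j ≠ c := fun i j h1 h2 => hne (by
    rw [(hx i j h1 h2).2]
    exact h1)
  have hcover : ∀ v, v ≠ c → ∃ i, 1 ≤ G.dist c v ∧ G.dist c v ≤ m i ∧ x i (G.dist c v) = v := by
    intro v hv
    have hp := hpos hv
    obtain ⟨i, hi⟩ := (hca _).1 (hbradj (G.dist c v - 1) v (by omega))
    have hle := hmax i v hv hi.symm
    obtain ⟨h1, h2⟩ := hx i _ hp hle
    exact ⟨i, hp, hle, hinj (G.dist c v - 1) _ _ (by omega) (by omega) (h1.trans hi)⟩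
  -- The neighbour of a vertex that is closer to `c` is the preceding vertex of its arm.
  have hpar : ∀ i j, j < m i → ∀ p, G.Adj (x i (j + 1)) p →
      G.dist c (x i (j + 1)) = G.dist c p + 1 → x i j = p := by
    intro i j hj p hp hd
    obtain ⟨h1, h2⟩ := hx i (j + 1) (by omega) (by omega)
    rcases Nat.eq_zero_or_pos j with rfl | hj0
    · rw [hx0]
      exact hG.connected.dist_eq_zero_iff.1 (by omega)
    · obtain ⟨h3, h4⟩ := hx i j hj0 hj.le
      have hpc : p ≠ c := hne (by omega)
      refine hinj (j - 1) _ _ (by omega) (by omega) ?_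
      rw [h3, ← hbr _ p hpc hp hd, h1]
  have hadj : ∀ v w, G.Adj w v → G.dist c w = G.dist c v + 1 →
      ∃ i, ∃ j < m i, v = x i j ∧ w = x i (j + 1) := by
    intro v w hvw hd
    obtain ⟨i, h1, h2, h3⟩ := hcover w (hne (by omega))
    rw [hd] at h2 h3
    refine ⟨i, G.dist c v, by omega, (hpar i _ (by omega) v ?_ ?_).symm, h3.symm⟩
    · rwa [h3]
    · rw [h3, hd]
  refine ⟨m, x, ⟨hm, hx0, fun v => ?_, ?_, hxne, fun i j hj => ?_, fun v w hvw => ?_⟩⟩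
  · by_cases hv : v = c
    · exact Or.inl hv
    · obtain ⟨i, hi⟩ := hcover v hv
      exact Or.inr ⟨i, _, hi⟩
  · intro i j i' j' h1 h2 h3 h4 h
    obtain ⟨h5, h6⟩ := hx i j h1 h2
    obtain ⟨h7, h8⟩ := hx i' j' h3 h4
    rw [h] at h5 h6
    exact ⟨ha (h5.symm.trans h7), h6.symm.trans h8⟩
  · obtain ⟨p, hp, hd⟩ :=
      hG.connected.exists_adj_dist_eq (hxne i (j + 1) (by omega) (by omega))
    rw [hpar i j hj p hp hd]
    exact hp.symm
  · rcases hG.dist_eq_dist_add_one_of_adj c hvw with hd | hd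
    · obtain ⟨i, j, hj, h⟩ := hadj w v hvw hd
      exact ⟨i, j, hj, Or.inr h⟩
    · obtain ⟨i, j, hj, h⟩ := hadj v w hvw.symm hd
      exact ⟨i, j, hj, Or.inl h⟩

theorem nonempty_iso_of_bijective {W : Type*} {G' : SimpleGraph W} {g : W → V}
    (hg : Function.Bijective g) (h₁ : ∀ s t, G'.Adj s t → G.Adj (g s) (g t))
    (h₂ : ∀ v w, G.Adj v w → ∃ s t, g s = v ∧ g t = w ∧ G'.Adj s t) : Nonempty (G ≃g G') := by
  refine ⟨RelIso.symm ⟨Equiv.ofBijective g hg, fun {s t} => ⟨fun h => ?_, h₁ s t⟩⟩⟩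
  obtain ⟨s', t', hs, ht, h'⟩ := h₂ _ _ h
  rwa [hg.1 hs, hg.1 ht] at h'

/-- Leaves do not separate: the other vertices of a tree are joined to `c` without using leaves
in the set `L`. -/
theorem IsTree.eqvGen_adj_compl_leaves (hG : G.IsTree) {c : V} {L : Set V} (hc : c ∉ L)
    (hL : ∀ l ∈ L, ∀ x y, G.Adj l x → G.Adj l y → x = y) :
    (∀ l ∈ L, ∃ p ∉ L, G.Adj l p) ∧
      ∀ v ∉ L, Relation.EqvGen (fun a b => a ∉ L ∧ b ∉ L ∧ G.Adj a b) c v := by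
  have hpar : ∀ v ≠ c, ∃ p ∉ L, G.Adj v p ∧ G.dist c v = G.dist c p + 1 := by
    intro v hv
    obtain ⟨p, hvp, hd⟩ := hG.connected.exists_adj_dist_eq hv
    refine ⟨p, fun hp => ?_, hvp, hd⟩
    obtain ⟨q, hpq, hd'⟩ := hG.connected.exists_adj_dist_eq (ne_of_mem_of_not_mem hp hc)
    have := hL p hp v q hvp.symm hpq
    subst this
    omega
  refine ⟨fun l hl => ?_, fun v hv => ?_⟩
  · obtain ⟨p, hp, hlp, -⟩ := hpar l (ne_of_mem_of_not_mem hl hc)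
    exact ⟨p, hp, hlp⟩
  · induction hk : G.dist c v generalizing v with
    | zero =>
      rw [hG.connected.dist_eq_zero_iff] at hk
      rw [hk]
      exact .refl _
    | succ k ih =>
      obtain ⟨p, hp, hvp, hd⟩ := hpar v (by rintro rfl; simp at hk)
      exact .trans _ _ _ (ih p hp (by omega)) (.rel _ _ ⟨hp, hv, hvp.symm⟩)

/-- A tree has at least four leaves if it has a vertex of degree at least four or two vertices of
degree at least three: the sum of `degree v - 2` over all vertices is `-2`. -/
theorem IsTree.four_le_card_leaves [Fintype V] [DecidableRel G.Adj] (hG : G.IsTree) {c : V}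
    (hc : 3 ≤ G.degree c) (h : 4 ≤ G.degree c ∨ ∃ b ≠ c, 3 ≤ G.degree b) :
    4 ≤ (Finset.univ.filter fun v => G.degree v = 1).card := by
  classical
  have hnt : Nontrivial V := by
    obtain ⟨v, hv⟩ := (G.degree_pos_iff_exists_adj c).1 (by omega)
    exact ⟨c, v, hv.ne⟩
  have hpos : ∀ v, 0 < G.degree v := fun v => hG.connected.preconnected.degree_pos_of_nontrivial v
  have hsum := G.sum_degrees_eq_twice_card_edges
  have hE := hG.card_edgeFinset
  -- Both indicators are needed at the same vertex `b = c` if `c` has degree at least four.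
  obtain ⟨b, hb⟩ : ∃ b, ∀ v, 2 + (if v = c then 1 else 0) + (if v = b then 1 else 0) ≤
      G.degree v + if G.degree v = 1 then 1 else 0 := by
    rcases h with h | ⟨b, hbc, hb⟩
    · refine ⟨c, fun v => ?_⟩
      have := hpos v
      by_cases hv : v = c
      · subst hv; simp; omega
      · simp only [hv, if_false]; split_ifs <;> omega
    · refine ⟨b, fun v => ?_⟩
      have := hpos v
      by_cases hv : v = c
      · subst hv; simp [hbc.symm]; omega
      · by_cases hv' : v = b
        · subst hv'; simp [hv]; omega
        · simp only [hv, hv', if_false]; split_ifs <;> omega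
  have := Finset.sum_le_sum fun v (_ : v ∈ Finset.univ) => hb v
  simp only [Finset.sum_add_distrib, Finset.sum_ite_eq', Finset.mem_univ, if_true,
    Finset.sum_const, Finset.card_univ, smul_eq_mul, ← Finset.card_filter] at this
  omega

end SimpleGraph

/-! ### Dynkin diagrams as spiders -/

namespace SimpleGraph.IsSpider

variable {V : Type*} {G : SimpleGraph V} {c : V}

theorem nonempty_iso_dynkinA {m : Fin 1 → ℕ} {x : Fin 1 → ℕ → V} (h : G.IsSpider c m x) :
    Nonempty (G ≃g dynkinA (m 0 + 1)) := by
  refine nonempty_iso_of_bijective (g := fun t => x 0 t) ⟨fun s t hst => ?_, fun v => ?_⟩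
    (fun s t hst => ?_) fun v w hvw => ?_
  · have hs := s.2
    have ht := t.2
    dsimp only at hst
    ext
    rcases Nat.eq_zero_or_pos s.val with hs0 | hs0 <;>
      rcases Nat.eq_zero_or_pos t.val with ht0 | ht0
    · omega
    · rw [hs0, h.zero] at hst
      exact absurd hst.symm (h.ne _ _ ht0 (by omega))
    · rw [ht0, h.zero] at hst
      exact absurd hst (h.ne _ _ hs0 (by omega))
    · exact (h.inj _ _ _ _ hs0 (by omega) ht0 (by omega) hst).2
  · rcases h.exists_eq v with rfl | ⟨i, j, -, hj, hv⟩
    · exact ⟨0, h.zero 0⟩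
    · obtain rfl := Subsingleton.elim i 0
      exact ⟨⟨j, by omega⟩, hv⟩
  · have hs := s.2
    have ht := t.2
    rcases SimpleGraph.pathGraph_adj.1 hst with h1 | h1
    · rw [← h1]
      exact h.adj 0 _ (by omega)
    · rw [← h1]
      exact (h.adj 0 _ (by omega)).symm
  · obtain ⟨i, j, hj, h1⟩ := h.exists_adj v w hvw
    obtain rfl := Subsingleton.elim i 0
    rcases h1 with ⟨rfl, rfl⟩ | ⟨rfl, rfl⟩
    · exact ⟨⟨j, by omega⟩, ⟨j + 1, by omega⟩, rfl, rfl, SimpleGraph.pathGraph_adj.2 (Or.inl rfl)⟩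
    · exact ⟨⟨j + 1, by omega⟩, ⟨j, by omega⟩, rfl, rfl, SimpleGraph.pathGraph_adj.2 (Or.inr rfl)⟩

/-- The arms `k` and `l` form the path of the branch graph, the arm `0` its additional vertex. -/
theorem nonempty_iso_branchGraph {m : Fin 3 → ℕ} {x : Fin 3 → ℕ → V} (h : G.IsSpider c m x)
    (h0 : m 0 = 1) {k l : Fin 3} (hk : k ≠ 0) (hl : l ≠ 0) (hkl : k ≠ l) :
    Nonempty (G ≃g branchGraph (m k + m l + 2) (m k)) := by
  have hadj : ∀ s t : Fin (m k + m l + 2), (branchGraph (m k + m l + 2) (m k)).Adj s t ↔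
      ((s.val + 1 = t.val ∧ t.val ≤ m k + m l) ∨ (s.val = m k ∧ t.val = m k + m l + 1)) ∨
      ((t.val + 1 = s.val ∧ s.val ≤ m k + m l) ∨ (t.val = m k ∧ s.val = m k + m l + 1)) := by
    intro s t
    simp only [branchGraph, SimpleGraph.fromRel_adj, ne_eq, Fin.ext_iff]
    have := h.one_le l
    omega
  -- The arm, and the distance from `c`, of the vertex of `G` corresponding to `t`.
  let pos : Fin (m k + m l + 2) → Fin 3 × ℕ := fun t =>
    if t.val ≤ m k then (k, m k - t) else if t.val ≤ m k + m l then (l, t - m k) else (0, 1)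
  let g : Fin (m k + m l + 2) → V := fun t => x (pos t).1 (pos t).2
  have hpos : ∀ t, (pos t).2 ≤ m (pos t).1 ∧ ((pos t).2 = 0 → t.val = m k) := fun t => by
    simp only [pos]
    split_ifs
    · dsimp only
      omega
    · dsimp only
      omega
    · exact ⟨h0.ge, fun h => absurd h (by simp)⟩
  have hposinj : ∀ s t, pos s = pos t → s = t := fun s t hst => by
    simp only [pos] at hst
    ext
    split_ifs at hst <;> simp only [Prod.mk.injEq, hkl, hkl.symm, hk, hk.symm, hl, hl.symm,
      false_and, true_and] at hst <;> omega
  have gk : ∀ j (hj : j ≤ m k), g ⟨m k - j, by omega⟩ = x k j := fun j hj => by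
    have h1 : m k - (m k - j) = j := by omega
    simp only [g, pos, if_pos (Nat.sub_le (m k) j), h1]
  have gl : ∀ j (hj : j ≤ m l), g ⟨m k + j, by omega⟩ = x l j := fun j hj => by
    rcases Nat.eq_zero_or_pos j with rfl | hj0
    · simp [g, pos, h.zero]
    · simp only [g, pos, if_neg (show ¬ m k + j ≤ m k by omega),
        if_pos (Nat.add_le_add_left hj _), Nat.add_sub_cancel_left]
  have g0 : g ⟨m k + m l + 1, by omega⟩ = x 0 1 := by
    simp only [g, pos, if_neg (show ¬ m k + m l + 1 ≤ m k by omega),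
      if_neg (show ¬ m k + m l + 1 ≤ m k + m l by omega)]
  have gc : g ⟨m k, by omega⟩ = c := (gl 0 (Nat.zero_le _)).trans (h.zero l)
  have hcase : ∀ i : Fin 3, i = 0 ∨ i = k ∨ i = l := by
    clear * - hk hl hkl
    revert k l
    decide
  -- Consecutive vertices of an arm are images of adjacent vertices of the branch graph.
  have hedge : ∀ i, ∀ j < m i, ∃ s t, g s = x i j ∧ g t = x i (j + 1) ∧
      (branchGraph (m k + m l + 2) (m k)).Adj s t := by
    intro i j hj
    rcases hcase i with rfl | rfl | rfl
    · obtain rfl : j = 0 := by omega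
      exact ⟨_, _, gc.trans (h.zero 0).symm, g0, (hadj _ _).2 (by simp)⟩
    · exact ⟨_, _, gk j hj.le, gk (j + 1) hj, (hadj _ _).2 (by simp only; omega)⟩
    · exact ⟨_, _, gl j hj.le, gl (j + 1) hj, (hadj _ _).2 (by simp only; omega)⟩
  have hadj' : ∀ s t : Fin (m k + m l + 2), (s.val + 1 = t.val ∧ t.val ≤ m k + m l) ∨
      (s.val = m k ∧ t.val = m k + m l + 1) → G.Adj (g s) (g t) := by
    rintro ⟨s, hs⟩ ⟨t, ht⟩ (⟨h1, h2⟩ | ⟨h1, h2⟩) <;> dsimp only at h1 h2 <;> subst h1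
    · rcases Nat.lt_or_ge s (m k) with hsk | hsk
      · have h3 := (h.adj k (m k - (s + 1)) (by omega)).symm
        rw [← gk _ (Nat.sub_le _ _), ← gk _ (by omega)] at h3
        convert h3 using 3 <;> omega
      · obtain ⟨j, rfl⟩ := Nat.exists_eq_add_of_le hsk
        have h3 := h.adj l j (by omega)
        rwa [← gl j (by omega), ← gl (j + 1) (by omega)] at h3
    · subst h2
      rw [gc, g0, ← h.zero 0]
      exact h.adj 0 0 (by omega)
  refine nonempty_iso_of_bijective (g := g) ⟨fun s t hst => ?_, fun v => ?_⟩
    (fun s t hst => ?_) fun v w hvw => ?_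
  · have hs := hpos s
    have ht := hpos t
    rcases Nat.eq_zero_or_pos (pos s).2 with hs0 | hs0 <;>
      rcases Nat.eq_zero_or_pos (pos t).2 with ht0 | ht0
    · exact Fin.ext ((hs.2 hs0).trans (ht.2 ht0).symm)
    · simp only [g, hs0, h.zero] at hst
      exact absurd hst.symm (h.ne _ _ ht0 ht.1)
    · simp only [g, ht0, h.zero] at hst
      exact absurd hst (h.ne _ _ hs0 hs.1)
    · obtain ⟨h1, h2⟩ := h.inj _ _ _ _ hs0 hs.1 ht0 ht.1 hst
      exact hposinj s t (Prod.ext h1 h2)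
  · rcases h.exists_eq v with rfl | ⟨i, j, hj1, hj, rfl⟩
    · exact ⟨_, gc⟩
    · obtain ⟨-, t, -, ht, -⟩ := hedge i (j - 1) (by omega)
      exact ⟨t, by rw [ht, Nat.sub_add_cancel hj1]⟩
  · rcases (hadj s t).1 hst with h1 | h1
    · exact hadj' s t h1
    · exact (hadj' t s h1).symm
  · obtain ⟨i, j, hj, h1⟩ := h.exists_adj v w hvw
    obtain ⟨s, t, hs, ht, hst⟩ := hedge i j hj
    rcases h1 with ⟨rfl, rfl⟩ | ⟨rfl, rfl⟩
    · exact ⟨s, t, hs, ht, hst⟩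
    · exact ⟨t, s, ht, hs, hst.symm⟩

end SimpleGraph.IsSpider

/-! ### The underlying simple graph of a quiver -/

section UnderlyingGraph

variable {V : Type u} [Quiver.{v + 1} V]

variable (V) in
/-- The simple graph of a quiver that forgets loops and the multiplicities of edges. -/
def underlyingGraph : SimpleGraph V := SimpleGraph.fromRel fun a b => Nonempty (a ⟶ b)

theorem underlyingGraph_adj {a b : V} :
    (underlyingGraph V).Adj a b ↔ a ≠ b ∧ (Nonempty (a ⟶ b) ∨ Nonempty (b ⟶ a)) :=
  SimpleGraph.fromRel_adj _ _ _

theorem QuiverConnected.eqvGen (h : QuiverConnected V) (a b : V) :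
    Relation.EqvGen (fun a b : V => Nonempty (a ⟶ b)) a b := by
  obtain ⟨p⟩ := h.2 a b
  induction p with
  | nil => exact .refl _
  | cons _ e ih =>
    refine .trans _ _ _ ih ?_
    rcases e with e | e
    · exact .rel _ _ ⟨e⟩
    · exact .symm _ _ (.rel _ _ ⟨e⟩)

/-- A connected quiver without arrows whose removal keeps it connected has no loops and no parallel
arrows, and its graph is a tree. -/
theorem underlyingGraph_isTree_and (hconn : QuiverConnected V)
    (h : ∀ e₀ : Quiver.Total V, ¬ ∀ a b, Relation.EqvGen
      (fun a b : V => ∃ e : a ⟶ b, (⟨a, b, e⟩ : Quiver.Total V) ≠ e₀) a b) :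
    (underlyingGraph V).IsTree ∧
      ∀ {W : Type} {G : SimpleGraph W}, Nonempty (underlyingGraph V ≃g G) →
        UnderlyingGraphIs V G := by
  have hsep : ∀ e₀ : Quiver.Total V, ¬ Relation.EqvGen
      (fun a b : V => ∃ e : a ⟶ b, (⟨a, b, e⟩ : Quiver.Total V) ≠ e₀) e₀.left e₀.right := by
    refine fun e₀ he => h e₀ fun a b => ?_
    induction hconn.eqvGen a b with
    | rel a b hab =>
      obtain ⟨e⟩ := hab
      by_cases hee : (⟨a, b, e⟩ : Quiver.Total V) = e₀
      · subst hee
        exact he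
      · exact .rel _ _ ⟨e, hee⟩
    | refl a => exact .refl _
    | symm a b _ ih => exact .symm _ _ ih
    | trans a b c _ _ ih₁ ih₂ => exact .trans _ _ _ ih₁ ih₂
  have hloop : ∀ e : Quiver.Total V, e.left ≠ e.right := fun e he => hsep e (by
    rw [he]
    exact .refl _)
  have hinj : ∀ e e' : Quiver.Total V, s(e.left, e.right) = s(e'.left, e'.right) → e = e' := by
    intro e e' hee
    by_contra hne
    refine hsep e' ?_
    rcases Sym2.eq_iff.1 hee with ⟨h1, h2⟩ | ⟨h1, h2⟩
    · rw [← h1, ← h2]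
      exact .rel _ _ ⟨e.hom, hne⟩
    · rw [← h1, ← h2]
      exact .symm _ _ (.rel _ _ ⟨e.hom, hne⟩)
  have hedge : ∀ e : Quiver.Total V, s(e.left, e.right) ∈ (underlyingGraph V).edgeSet := fun e =>
    underlyingGraph_adj.2 ⟨hloop e, Or.inl ⟨e.hom⟩⟩
  have hsurj : ∀ a b, (underlyingGraph V).Adj a b →
      ∃ e : Quiver.Total V, s(e.left, e.right) = s(a, b) := by
    intro a b hab
    obtain ⟨-, ⟨⟨e⟩⟩ | ⟨⟨e⟩⟩⟩ := underlyingGraph_adj.1 hab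
    · exact ⟨⟨a, b, e⟩, rfl⟩
    · exact ⟨⟨b, a, e⟩, Sym2.eq_swap⟩
  have := hconn.1
  refine ⟨⟨⟨fun a b => ?_⟩, ?_⟩, ?_⟩
  · induction hconn.eqvGen a b with
    | rel a b hab =>
      obtain ⟨e⟩ := hab
      exact SimpleGraph.Adj.reachable (hedge ⟨a, b, e⟩)
    | refl a => rfl
    | symm a b _ ih => exact ih.symm
    | trans a b c _ _ ih₁ ih₂ => exact ih₁.trans ih₂
  · rw [SimpleGraph.isAcyclic_iff_forall_adj_isBridge]
    intro a b hab
    obtain ⟨e₀, he₀⟩ := hsurj a b hab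
    rw [← he₀, SimpleGraph.isBridge_iff]
    suffices hw : ∀ x y, ((underlyingGraph V).deleteEdges {s(e₀.left, e₀.right)}).Walk x y →
        Relation.EqvGen (fun a b : V => ∃ e : a ⟶ b, (⟨a, b, e⟩ : Quiver.Total V) ≠ e₀) x y from
      fun ⟨p⟩ => hsep e₀ (hw _ _ p)
    intro x y p
    induction p with
    | nil => exact .refl _
    | cons hxy _ ih =>
      refine .trans _ _ _ ?_ ih
      rw [SimpleGraph.deleteEdges_adj, Set.mem_singleton_iff] at hxy
      obtain ⟨-, ⟨⟨e⟩⟩ | ⟨⟨e⟩⟩⟩ := underlyingGraph_adj.1 hxy.1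
      · refine .rel _ _ ⟨e, ?_⟩
        rintro rfl
        exact hxy.2 rfl
      · refine .symm _ _ (.rel _ _ ⟨e, ?_⟩)
        rintro rfl
        exact hxy.2 Sym2.eq_swap
  · rintro W G ⟨φ⟩
    let ψ : Quiver.Total V → (underlyingGraph V).edgeSet := fun e => ⟨_, hedge e⟩
    have hψ : Function.Bijective ψ := by
      refine ⟨fun e e' hee => hinj e e' (congrArg Subtype.val hee), ?_⟩
      rintro ⟨e, he⟩
      induction e with
      | h a b =>
        obtain ⟨e₀, he₀⟩ := hsurj a b he
        exact ⟨e₀, Subtype.ext he₀⟩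
    exact ⟨φ.toEquiv, (Equiv.ofBijective ψ hψ).trans φ.mapEdgeSet, fun e => rfl⟩

end UnderlyingGraph

namespace HilbertRep

variable {V : Type u} [Quiver.{v + 1} V]

open ShiftSpace

theorem exists_indecomposable_of_isSpider {c : V} {n N : ℕ} {m : Fin n → ℕ} {x : Fin n → ℕ → V}
    (h : (underlyingGraph V).IsSpider c m x) (i₀ : Fin N) (S : Fin n → ClosedFlag (Power.{w} N))
    (hS : HasTrivialIdempotents S) (hlen : ∀ i, (S i).len ≤ m i) :
    ∃ R : HilbertRep.{u, v, w} V,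
      R.IsSeparable ∧ R.IsInfiniteDimensional ∧ R.IsIndecomposable := by
  refine exists_indecomposable_of_flags (power_not_finiteDimensional i₀) S hS {c} c rfl ?_ x
    h.zero (fun i j h1 h2 => h.ne i j h1 (h2.trans (hlen i)))
    (fun i j i' j' h1 h2 h3 h4 => h.inj i j i' j' h1 (h2.trans (hlen i)) h3 (h4.trans (hlen i')))
    fun i j hj => (underlyingGraph_adj.1 (h.adj i j (hj.trans_le (hlen i)))).2.symm
  rintro a rfl
  exact .refl _

/-- If a tree has four leaves, the representation with the flags `flagsD` has the total space at
every vertex other than these leaves. -/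
theorem exists_indecomposable_of_four_leaves (hG : (underlyingGraph V).IsTree) {l : Fin 4 → V}
    (hl : Function.Injective l)
    (hleaf : ∀ i x y, (underlyingGraph V).Adj (l i) x → (underlyingGraph V).Adj (l i) y → x = y)
    {c : V} (hc : ∀ i, l i ≠ c) :
    ∃ R : HilbertRep.{u, v, w} V,
      R.IsSeparable ∧ R.IsInfiniteDimensional ∧ R.IsIndecomposable := by
  obtain ⟨hpar, hcore⟩ := hG.eqvGen_adj_compl_leaves (c := c) (L := Set.range l)
    (by rintro ⟨i, hi⟩; exact hc i hi) (by rintro _ ⟨i, rfl⟩; exact hleaf i)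
  choose p hp hlp using fun i => hpar (l i) ⟨i, rfl⟩
  have hlen : ∀ i, (flagsD.{w} i).len = 1 := by
    intro i
    fin_cases i <;> rfl
  refine exists_indecomposable_of_flags (power_not_finiteDimensional 0) flagsD.{w}
    flagsD_hasTrivialIdempotents (Set.range l)ᶜ c (by rintro ⟨i, hi⟩; exact hc i hi)
    (fun a ha => ?_)
    (fun i j => if j = 0 then p i else l i) (fun i => hp i) (fun i j h1 _ => ?_)
    (fun i j i' j' h1 h2 h3 h4 h5 => ?_) fun i j hj => ?_
  · replace ha := hcore a ha
    clear * - ha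
    induction ha with
    | rel a b hab =>
      obtain ⟨ha, hb, hab⟩ := hab
      rcases (underlyingGraph_adj.1 hab).2 with h | h
      · exact .rel _ _ ⟨ha, hb, h⟩
      · exact .symm _ _ (.rel _ _ ⟨hb, ha, h⟩)
    | refl a => exact .refl _
    | symm a b _ ih => exact .symm _ _ ih
    | trans a b c _ _ ih₁ ih₂ => exact .trans _ _ _ ih₁ ih₂
  · simp [Nat.one_le_iff_ne_zero.1 h1]
  · rw [if_neg (Nat.one_le_iff_ne_zero.1 h1), if_neg (Nat.one_le_iff_ne_zero.1 h3)] at h5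
    rw [hlen] at h2 h4
    exact ⟨hl h5, by omega⟩
  · rw [hlen, Nat.lt_one_iff] at hj
    subst hj
    simpa using (underlyingGraph_adj.1 (hlp i)).2

end HilbertRep

/-! ### The classification -/

theorem mainTheorem2 (V : Type u) [Quiver.{v + 1} V] [Finite V] [Finite (Quiver.Total V)]
    (hconn : QuiverConnected V)
    (h : ¬ ∃ R : HilbertRep.{u, v, w} V,
      R.IsSeparable ∧ R.IsInfiniteDimensional ∧ R.IsIndecomposable) :
    (∃ n : ℕ, 1 ≤ n ∧ UnderlyingGraphIs V (dynkinA n)) ∨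
      (∃ n : ℕ, 4 ≤ n ∧ UnderlyingGraphIs V (dynkinD n)) ∨
      UnderlyingGraphIs V (dynkinE 6) ∨ UnderlyingGraphIs V (dynkinE 7) ∨
      UnderlyingGraphIs V (dynkinE 8) := by
  classical
  obtain ⟨hG, hiso⟩ := underlyingGraph_isTree_and hconn fun e₀ he =>
    h (HilbertRep.exists_indecomposable_of_connected_ne e₀ he)
  have := Fintype.ofFinite V
  have hdeg : ∀ v : V, (underlyingGraph V).degree v ≤ 2 → ∀ x y z, (underlyingGraph V).Adj v x →
      (underlyingGraph V).Adj v y → (underlyingGraph V).Adj v z → x = y ∨ x = z ∨ y = z := by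
    intro v hv x y z hx hy hz
    by_contra! hne
    refine hv.not_gt (Finset.two_lt_card.2 ⟨x, ?_, y, ?_, z, ?_, hne⟩) <;> simpa
  have hnbr : ∀ {n : ℕ} {c : V}, (underlyingGraph V).degree c = n → ∃ a : Fin n → V,
      Function.Injective a ∧ ∀ v, (underlyingGraph V).Adj c v ↔ ∃ i, a i = v := by
    intro n c hn
    let φ := ((underlyingGraph V).neighborFinset c).equivFinOfCardEq hn
    refine ⟨fun i => φ.symm i, Subtype.val_injective.comp φ.symm.injective, fun v => ?_⟩
    rw [← SimpleGraph.mem_neighborFinset]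
    exact ⟨fun hv => ⟨φ ⟨v, hv⟩, by simp⟩, by rintro ⟨i, rfl⟩; exact (φ.symm i).2⟩
  by_cases hall : ∀ v, (underlyingGraph V).degree v ≤ 2
  · left
    rcases subsingleton_or_nontrivial V with hV | hV
    · obtain ⟨c⟩ := hconn.1
      refine ⟨1, le_rfl, hiso (SimpleGraph.nonempty_iso_of_bijective (g := fun _ => c)
        ⟨fun s t _ => Subsingleton.elim s t, fun v => ⟨0, Subsingleton.elim _ _⟩⟩
        (fun s t hst => ?_) fun v w hvw => ?_)⟩
      · exact absurd (Subsingleton.elim s t) hst.ne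
      · exact absurd (Subsingleton.elim v w) hvw.ne
    · obtain ⟨c, hc⟩ := hG.exists_vert_degree_one_of_nontrivial
      obtain ⟨a, ha, hca⟩ := hnbr hc
      obtain ⟨m, x, -, hx⟩ := hG.exists_isSpider (fun v _ => hdeg v (hall v)) ha hca
      exact ⟨m 0 + 1, by omega, hiso hx.nonempty_iso_dynkinA⟩
  right
  push Not at hall
  obtain ⟨c, hc⟩ := hall
  have hno : ¬ (4 ≤ (underlyingGraph V).degree c ∨
      ∃ b ≠ c, 3 ≤ (underlyingGraph V).degree b) := by
    intro hbr
    have h4 := hG.four_le_card_leaves hc hbr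
    rw [← Fintype.card_subtype] at h4
    obtain ⟨l⟩ := Function.Embedding.nonempty_of_card_le ((Fintype.card_fin 4).trans_le h4)
    refine h (HilbertRep.exists_indecomposable_of_four_leaves hG (c := c) (l := fun i => (l i).1)
      (Subtype.val_injective.comp l.injective) (fun i x y hx hy => ?_) fun i hi => ?_)
    · refine Finset.card_le_one.1 (l i).2.le x ?_ y ?_ <;> simpa
    · have := (l i).2
      rw [hi] at this
      omega
  push Not at hno
  obtain ⟨a, ha, hca⟩ := hnbr (n := 3) (c := c) (by omega)
  obtain ⟨m, x, hm, hx⟩ := hG.exists_isSpider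
    (fun v hv => hdeg v (Nat.le_of_lt_succ (hno.2 v hv))) ha hca
  have h0 := hx.one_le 0
  have h01 : m 0 ≤ m 1 := hm (by decide)
  have h12 : m 1 ≤ m 2 := hm (by decide)
  -- The arms are too short for the extended Dynkin diagrams `E₆`, `E₇` and `E₈`.
  have hE₆ : m 0 < 2 := by
    by_contra! hlt
    refine h (HilbertRep.exists_indecomposable_of_isSpider hx 0 _
      ShiftSpace.flagsE₆_hasTrivialIdempotents fun i => ?_)
    fin_cases i
    exacts [hlt, hlt.trans h01, hlt.trans (h01.trans h12)]
  have hE₇ : m 1 < 3 := by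
    by_contra! hlt
    refine h (HilbertRep.exists_indecomposable_of_isSpider hx 0 _
      ShiftSpace.flagsE₇_hasTrivialIdempotents fun i => ?_)
    fin_cases i
    exacts [h0, hlt, hlt.trans h12]
  have hm0 : m 0 = 1 := by omega
  rcases (by omega : m 1 = 1 ∨ m 1 = 2) with hm1 | hm1
  · left
    have hD := hx.nonempty_iso_branchGraph hm0 (k := 2) (l := 1) (by decide) (by decide) (by decide)
    rw [hm1] at hD
    exact ⟨m 2 + 1 + 2, by omega, hiso hD⟩
  right
  have hE₈ : m 2 < 5 := by
    by_contra! hlt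
    refine h (HilbertRep.exists_indecomposable_of_isSpider hx 0 _
      ShiftSpace.flagsE₈_hasTrivialIdempotents fun i => ?_)
    fin_cases i
    exacts [h0, hm1.ge, hlt]
  have hE := hx.nonempty_iso_branchGraph hm0 (k := 1) (l := 2) (by decide) (by decide) (by decide)
  rw [hm1] at hE
  rcases (by omega : m 2 = 2 ∨ m 2 = 3 ∨ m 2 = 4) with hm2 | hm2 | hm2 <;> rw [hm2] at hE
  exacts [Or.inl (hiso hE), Or.inr (Or.inl (hiso hE)), Or.inr (Or.inr (hiso hE))]
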